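/- Conventions. All manifolds are smooth, Hausdorff and second countable; all tensors are smooth. A Hermitian manifold $(M,J,g)$ of complex dimension $n\ge 2$ is a manifold with an integrable almost complex structure $J$ and a Riemannian metric $g$ with $g(J\cdot,J\cdot)=g$; its fundamental form is $\omega=g(J\cdot,\cdot)$. It is locally conformally Kähler (lcK) with Lee form $\theta$ if $\theta$ is a closed $1$-form with $d\omega=\theta\wedge\omega$; the Lee field is the vector field $T=\theta^\sharp$, i.e. $g(T,\cdot)=\theta$. It is Vaisman if moreover $\theta$ is parallel for the Levi-Civita connection of $g$. $J$ acts on $1$-forms by $J\alpha=-\alpha\circ J$, so that $J\theta=g(JT,\cdot)$. A vector field $X$ is holomorphic if $\mathcal L_XJ=0$. (1) Let $(M,J,g)$ be a Vaisman manifold of complex dimension $n\ge2$ whose Lee form $\theta$ satisfies $|\theta|=1$, and let $T=\theta^\sharp$. For a function $f$ on $M$, $df\wedge\theta=0$ if and only if the gradient of $f$ is everywhere a multiple of $T$. Let $f\in C^\infty(M)$ be non-constant with $f>-1$ and $df\wedge\theta=0$, and put $$\bar\omega=\omega+f\,\theta\wedge J\theta,\qquad \bar g=\bar\omega(\cdot,J\cdot).$$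 Then $\bar g$ is a Riemannian metric, $(M,J,\bar g)$ is lcK with fundamental form $\bar\omega$, with Lee form $\bar\theta=(1+f)\theta$, and with the same Lee field $\bar T=T$, which is holomorphic. Moreover $\bar g(\bar T,\bar T)=1+f$, so the norm of the Lee field of $\bar g$ is not constant; if $M$ is connected, then $(M,J,\bar g)$ is not Vaisman. (2) Let $n\ge 2$, $a>1$, and let $M$ be the Hopf manifold $(\mathbb C^n\setminus\{0\})/\langle x\mapsto ax\rangle$. Then $M$ is a compact connected manifold diffeomorphic to $S^1\times S^{2n-1}$. With $r=|x|$, the standard complex structure, the metric $4r^{-2}g_{\mathbb C^n}$ and the form $-2\,dr/r$ descend to a Vaisman structure $(J,g)$ on $M$ with Lee form $\theta$ of norm $1$. If $h\colon(0,\infty)\to\mathbb R$ is smooth and non-constant, with $|h|<1$ and $h(ar)=h(r)$ for all $r$, for instance $h(r)=\tfrac12\sin(2\pi\ln r/\ln a)$, then $h(r)$ descends to a function $f$ on $M$ that satisfies the hypotheses of (1), and $\bar g$ is an lcK metric on the compact manifold $M$ with Lee form $(1+f)\theta$ and holomorphic Lee field that is not Vaisman. -/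

import Mathlib

open scoped Manifold ContDiff Topology

universe u v

namespace LCK

open Bundle

noncomputable section

/-! ### Tensor fields on a smooth manifold modelled on a real normed space -/

section Forms

variable {E : Type*} [NormedAddCommGroup E] [NormedSpace ℝ E]
  {M : Type*} [TopologicalSpace M] [ChartedSpace E M]

variable (E M) in
/-- (Not necessarily smooth) vector fields. -/
abbrev VField := ∀ x : M, TangentSpace 𝓘(ℝ, E) x

variable (E M) in
/-- (Not necessarily smooth) `1`-forms. -/
abbrev Form1 := ∀ x : M, TangentSpace 𝓘(ℝ, E) x →L[ℝ] ℝ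

variable (E M) in
/-- (Not necessarily smooth) bilinear forms; `2`-forms are the alternating ones. -/
abbrev Form2 := ∀ x : M, TangentSpace 𝓘(ℝ, E) x →L[ℝ] TangentSpace 𝓘(ℝ, E) x →L[ℝ] ℝ

variable (E M) in
/-- (Not necessarily smooth) fields of endomorphisms of the tangent bundle. -/
abbrev EndField := ∀ x : M, TangentSpace 𝓘(ℝ, E) x →L[ℝ] TangentSpace 𝓘(ℝ, E) x

/-- The differential of a real function, as a `1`-form. -/
def diff (f : M → ℝ) : Form1 E M := fun x ↦ mvfderiv 𝓘(ℝ, E) f x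

/-- `α ∧ β` for `1`-forms: `(α ∧ β)(v, w) = α(v) β(w) - α(w) β(v)`. -/
def wedge (α β : Form1 E M) : Form2 E M :=
  fun x ↦ (α x).smulRight (β x) - (β x).smulRight (α x)

/-- `(α ∧ η)(u, v, w)` for a `1`-form `α` and a `2`-form `η`. -/
def wedge12 (α : Form1 E M) (η : Form2 E M) (x : M) (u v w : TangentSpace 𝓘(ℝ, E) x) : ℝ :=
  α x u * η x v w - α x v * η x u w + α x w * η x u v

/-- The vector field `X` is differentiable at the point `x`. -/
def DiffAt [IsManifold 𝓘(ℝ, E) 1 M] (X : VField E M) (x : M) : Prop :=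
  MDifferentiableAt 𝓘(ℝ, E) (𝓘(ℝ, E).prod 𝓘(ℝ, E))
    (fun y ↦ (TotalSpace.mk' E y (X y) : TangentBundle 𝓘(ℝ, E) M)) x

/-- The Lie bracket of vector fields. -/
def bracket (X Y : VField E M) : VField E M := VectorField.mlieBracket 𝓘(ℝ, E) X Y

/-- `dα(X, Y) = X(α(Y)) - Y(α(X)) - α([X, Y])` for a `1`-form `α`. -/
def extDeriv1 (α : Form1 E M) (X Y : VField E M) (x : M) : ℝ :=
  diff (fun y ↦ α y (Y y)) x (X x) - diff (fun y ↦ α y (X y)) x (Y x) - α x (bracket X Y x)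

/-- The exterior derivative of a `2`-form `η`:
`dη(X, Y, Z) = X(η(Y, Z)) - Y(η(X, Z)) + Z(η(X, Y)) - η([X, Y], Z) + η([X, Z], Y) - η([Y, Z], X)`.
-/
def extDeriv2 (η : Form2 E M) (X Y Z : VField E M) (x : M) : ℝ :=
  diff (fun y ↦ η y (Y y) (Z y)) x (X x) - diff (fun y ↦ η y (X y) (Z y)) x (Y x)
    + diff (fun y ↦ η y (X y) (Y y)) x (Z x)
    - η x (bracket X Y x) (Z x) + η x (bracket X Z x) (Y x) - η x (bracket Y Z x) (X x)

variable [IsManifold 𝓘(ℝ, E) ∞ M]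

/-- Smooth vector fields. -/
def SmoothVField (X : VField E M) : Prop :=
  ContMDiff 𝓘(ℝ, E) (𝓘(ℝ, E).prod 𝓘(ℝ, E)) ∞
    (fun x ↦ (TotalSpace.mk' E x (X x) : TangentBundle 𝓘(ℝ, E) M))

/-- Smooth `1`-forms, i.e. smooth sections of the cotangent bundle. -/
def SmoothForm1 (α : Form1 E M) : Prop :=
  ContMDiff 𝓘(ℝ, E) (𝓘(ℝ, E).prod 𝓘(ℝ, E →L[ℝ] ℝ)) ∞
    (fun x ↦ TotalSpace.mk' (E →L[ℝ] ℝ)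
      (E := fun x : M ↦ TangentSpace 𝓘(ℝ, E) x →L[ℝ] Bundle.Trivial M ℝ x) x (α x))

/-- A `1`-form `α` is closed: `dα = 0`. -/
def Closed1 (α : Form1 E M) : Prop :=
  ∀ (x : M) (X Y : VField E M), DiffAt X x → DiffAt Y x → extDeriv1 α X Y x = 0

variable (E M) in
/-- An integrable almost complex structure: a smooth field `J` of endomorphisms of the tangent
bundle with `J² = -1` and vanishing Nijenhuis tensor. -/
structure ComplexStructure where
  /-- The endomorphism field. -/
  toFun : EndField E M
  smooth : ContMDiff 𝓘(ℝ, E) (𝓘(ℝ, E).prod 𝓘(ℝ, E →L[ℝ] E)) ∞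
    (fun x ↦ TotalSpace.mk' (E →L[ℝ] E)
      (E := fun x : M ↦ TangentSpace 𝓘(ℝ, E) x →L[ℝ] TangentSpace 𝓘(ℝ, E) x) x (toFun x))
  sq : ∀ (x : M) (v : TangentSpace 𝓘(ℝ, E) x), toFun x (toFun x v) = -v
  nijenhuis : ∀ (x : M) (X Y : VField E M), DiffAt X x → DiffAt Y x →
    bracket (fun y ↦ toFun y (X y)) (fun y ↦ toFun y (Y y)) x
      - toFun x (bracket (fun y ↦ toFun y (X y)) Y x)
      - toFun x (bracket X (fun y ↦ toFun y (Y y)) x)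
      - bracket X Y x = 0

instance : CoeFun (ComplexStructure E M) (fun _ ↦ EndField E M) := ⟨ComplexStructure.toFun⟩

variable (E M) in
/-- Smooth Riemannian metrics on `M`. -/
abbrev RMetric := ContMDiffRiemannianMetric 𝓘(ℝ, E) ∞ E (fun x : M ↦ TangentSpace 𝓘(ℝ, E) x)

/-- The action of `J` on `1`-forms. It is the one that corresponds to `J` on vectors under the
metric duality of a Hermitian metric: if `α = g(A, ·)`, then `Jα = g(JA, ·)`. -/
def ComplexStructure.onForm (J : ComplexStructure E M) (α : Form1 E M) : Form1 E M :=
  fun x ↦ -(α x).comp (J x)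

/-- `X` is a (real) holomorphic vector field: smooth with `𝓛_X J = 0`, that is
`[X, JY] = J[X, Y]` for all `Y`. -/
def IsHolomorphic (J : ComplexStructure E M) (X : VField E M) : Prop :=
  SmoothVField X ∧ ∀ (x : M) (Y : VField E M), DiffAt Y x →
    bracket X (fun y ↦ J y (Y y)) x = J x (bracket X Y x)

/-- `g` is Hermitian with respect to `J`. -/
def IsHermitian (J : ComplexStructure E M) (g : RMetric E M) : Prop :=
  ∀ (x : M) (v w : TangentSpace 𝓘(ℝ, E) x), g.inner x (J x v) (J x w) = g.inner x v w

/-- The fundamental form `ω = g(J ·, ·)`. -/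
def fundamentalForm (J : ComplexStructure E M) (g : RMetric E M) : Form2 E M :=
  fun x ↦ (g.inner x).comp (J x)

/-- `(M, J, g)` is locally conformally Kähler with Lee form `θ`: `g` is Hermitian, `θ` is a smooth
closed `1`-form, and `dω = θ ∧ ω`. -/
structure IsLCKWith (J : ComplexStructure E M) (g : RMetric E M) (θ : Form1 E M) : Prop where
  hermitian : IsHermitian J g
  smooth : SmoothForm1 θ
  closed : Closed1 θ
  lee : ∀ (x : M) (X Y Z : VField E M), DiffAt X x → DiffAt Y x → DiffAt Z x →
    extDeriv2 (fundamentalForm J g) X Y Z x =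
      wedge12 θ (fundamentalForm J g) x (X x) (Y x) (Z x)

/-- A covariant derivative on the tangent bundle is the Levi-Civita connection of `g`: it is
torsion-free and metric. Here `D Y x v` is `(∇_v Y)(x)`. -/
structure IsLeviCivita (g : RMetric E M)
    (D : CovariantDerivative 𝓘(ℝ, E) E (fun x : M ↦ TangentSpace 𝓘(ℝ, E) x)) : Prop where
  torsion_free : ∀ (x : M) (X Y : VField E M), DiffAt X x → DiffAt Y x →
    D Y x (X x) - D X x (Y x) = bracket X Y x
  metric : ∀ (x : M) (v : TangentSpace 𝓘(ℝ, E) x) (Y Z : VField E M), DiffAt Y x → DiffAt Z x →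
    diff (fun y ↦ g.inner y (Y y) (Z y)) x v =
      g.inner x (D Y x v) (Z x) + g.inner x (Y x) (D Z x v)

/-- The `1`-form `α` is parallel with respect to the Levi-Civita connection of `g`:
`(∇_v α)(Y) = v(α(Y)) - α(∇_v Y) = 0`. -/
def IsParallel (g : RMetric E M) (α : Form1 E M) : Prop :=
  ∃ D : CovariantDerivative 𝓘(ℝ, E) E (fun x : M ↦ TangentSpace 𝓘(ℝ, E) x),
    IsLeviCivita g D ∧
      ∀ (x : M) (v : TangentSpace 𝓘(ℝ, E) x) (Y : VField E M), DiffAt Y x →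
        diff (fun y ↦ α y (Y y)) x v - α x (D Y x v) = 0

/-- `(M, J, g)` is Vaisman with Lee form `θ`. -/
def IsVaismanWith (J : ComplexStructure E M) (g : RMetric E M) (θ : Form1 E M) : Prop :=
  IsLCKWith J g θ ∧ IsParallel g θ

/-- `(M, J, g)` is Vaisman. -/
def IsVaisman (J : ComplexStructure E M) (g : RMetric E M) : Prop :=
  ∃ θ : Form1 E M, IsVaismanWith J g θ

theorem exists_sharp [FiniteDimensional ℝ E] (g : RMetric E M) (α : Form1 E M) (x : M) :
    ∃ v : TangentSpace 𝓘(ℝ, E) x, ∀ w, g.inner x v w = α x w := by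
  have : FiniteDimensional ℝ (TangentSpace 𝓘(ℝ, E) x) := inferInstanceAs (FiniteDimensional ℝ E)
  let L : TangentSpace 𝓘(ℝ, E) x →ₗ[ℝ] Module.Dual ℝ (TangentSpace 𝓘(ℝ, E) x) :=
    { toFun := fun v ↦ (g.inner x v).toLinearMap
      map_add' := fun v w ↦ by ext; simp
      map_smul' := fun c v ↦ by ext; simp }
  have hinj : Function.Injective L := by
    rw [injective_iff_map_eq_zero]
    intro v hv
    by_contra hne
    have h1 := g.pos x v hne
    have h2 : g.inner x v v = 0 := LinearMap.congr_fun hv v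
    exact absurd h2 h1.ne'
  have hsurj : Function.Surjective L :=
    (LinearMap.injective_iff_surjective_of_finrank_eq_finrank
      (Subspace.dual_finrank_eq (K := ℝ)).symm).1 hinj
  obtain ⟨v, hv⟩ := hsurj (α x).toLinearMap
  exact ⟨v, fun w ↦ LinearMap.congr_fun hv w⟩

/-- The vector field `α♯` that is metrically dual to the `1`-form `α`. -/
def sharp [FiniteDimensional ℝ E] (g : RMetric E M) (α : Form1 E M) : VField E M :=
  fun x ↦ Classical.choose (exists_sharp g α x)

theorem inner_sharp [FiniteDimensional ℝ E] (g : RMetric E M) (α : Form1 E M) (x : M)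
    (w : TangentSpace 𝓘(ℝ, E) x) : g.inner x (sharp g α x) w = α x w :=
  Classical.choose_spec (exists_sharp g α x) w

/-- The pointwise norm of a vector field. -/
def vnorm (g : RMetric E M) (X : VField E M) (x : M) : ℝ := √(g.inner x (X x) (X x))

/-- The pointwise norm of a `1`-form. -/
def fnorm [FiniteDimensional ℝ E] (g : RMetric E M) (α : Form1 E M) : M → ℝ := vnorm g (sharp g α)

/-- The deformed form `ω + f θ ∧ Jθ`. -/
def deformedForm (J : ComplexStructure E M) (g : RMetric E M) (θ : Form1 E M) (f : M → ℝ) :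
    Form2 E M :=
  fun x ↦ fundamentalForm J g x + f x • wedge θ (J.onForm θ) x

/-- `f` is a smooth non-constant function with `f > -1` and `df ∧ θ = 0`. -/
structure IsAdmissible (θ : Form1 E M) (f : M → ℝ) : Prop where
  smooth : ContMDiff 𝓘(ℝ, E) 𝓘(ℝ, ℝ) ∞ f
  nonconst : ¬ ∃ c : ℝ, ∀ x, f x = c
  gt_neg_one : ∀ x, -1 < f x
  wedge_eq_zero : ∀ x, wedge (diff f) θ x = 0

end Forms

/-! ### The Hopf manifold -/

section Hopf

/-- `ℂⁿ` with its Euclidean norm. -/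
abbrev Cn (n : ℕ) := EuclideanSpace ℂ (Fin n)

/-- `ℂⁿ \ {0}`. -/
def punctured (n : ℕ) : TopologicalSpace.Opens (Cn n) := ⟨{0}ᶜ, isOpen_compl_singleton⟩

/-- The infinite cyclic group of dilations `x ↦ aᵏ x`, `k ∈ ℤ`. -/
def Dilations (_a : ℝ) := Multiplicative ℤ

instance (a : ℝ) : CommGroup (Dilations a) := inferInstanceAs (CommGroup (Multiplicative ℤ))

/-- The exponent `k` of the dilation `x ↦ aᵏ x`. -/
def Dilations.exponent {a : ℝ} (k : Dilations a) : ℤ := Multiplicative.toAdd (k : Multiplicative ℤ)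

variable {n : ℕ} {a : ℝ} [ha : Fact (1 < a)]

theorem punctured_ne_zero (x : punctured n) : (x : Cn n) ≠ 0 := x.2

theorem dilation_pos (k : ℤ) : 0 < a ^ k := zpow_pos (zero_lt_one.trans ha.out) k

instance : MulAction (Dilations a) (punctured n) where
  smul k x := ⟨a ^ k.exponent • (x : Cn n),
    smul_ne_zero (dilation_pos k.exponent).ne' (punctured_ne_zero x)⟩
  one_smul x := Subtype.ext (by
    change a ^ (0 : ℤ) • (x : Cn n) = x
    simp)
  mul_smul k l x := Subtype.ext (by
    change a ^ (k.exponent + l.exponent) • (x : Cn n) = a ^ k.exponent • a ^ l.exponent • (x : Cn n)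
    rw [zpow_add₀ (zero_lt_one.trans ha.out).ne', mul_smul])

theorem coe_dilation_smul (k : Dilations a) (x : punctured n) :
    ((k • x : punctured n) : Cn n) = a ^ k.exponent • (x : Cn n) := rfl

instance : ContinuousConstSMul (Dilations a) (punctured n) where
  continuous_const_smul k :=
    (continuous_subtype_val.const_smul (a ^ k.exponent)).subtype_mk _

instance : IsCancelSMul (Dilations a) (punctured n) where
  left_cancel' k x y h := by
    have := congrArg (fun z ↦ k⁻¹ • z) h
    simpa using this
  right_cancel' k l x h := by
    have h1 : a ^ k.exponent • (x : Cn n) = a ^ l.exponent • (x : Cn n) := congrArg Subtype.val h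
    exact zpow_right_injective₀ (zero_lt_one.trans ha.out) ha.out.ne'
      (smul_left_injective ℝ (punctured_ne_zero x) h1)

instance : ProperlyDiscontinuousSMul (Dilations a) (punctured n) where
  finite_disjoint_inter_image {K L} hK hL := by
    have hlog : Continuous fun x : punctured n ↦ Real.log ‖(x : Cn n)‖ :=
      continuous_subtype_val.norm.log fun x ↦ norm_ne_zero_iff.2 (punctured_ne_zero x)
    obtain ⟨B, hB⟩ := (hK.image hlog).isBounded.exists_norm_le
    obtain ⟨C, hC⟩ := (hL.image hlog).isBounded.exists_norm_le
    have hla : 0 < Real.log a := Real.log_pos ha.out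
    have hfin : (Set.Icc (-⌈(B + C) / Real.log a⌉) ⌈(B + C) / Real.log a⌉ : Set ℤ).Finite :=
      Set.finite_Icc _ _
    have hfin' : {k : ℤ | |(k : ℝ)| ≤ (B + C) / Real.log a}.Finite := by
      refine hfin.subset fun k hk ↦ ?_
      have hk' := abs_le.1 (show |(k : ℝ)| ≤ (B + C) / Real.log a from hk)
      have hc := Int.le_ceil ((B + C) / Real.log a)
      constructor
      · exact_mod_cast (by push_cast; linarith : ((-⌈(B + C) / Real.log a⌉ : ℤ) : ℝ) ≤ k)
      · exact_mod_cast hk'.2.trans hc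
    refine Set.Finite.subset hfin' ?_
    · rintro (k : Dilations a) ⟨_, ⟨x, hx, rfl⟩, hy⟩
      have h1 : |Real.log ‖(x : Cn n)‖| ≤ B := hB _ ⟨x, hx, rfl⟩
      have h2 : |Real.log ‖((k • x : punctured n) : Cn n)‖| ≤ C := hC _ ⟨_, hy, rfl⟩
      rw [coe_dilation_smul, norm_smul, Real.norm_of_nonneg (dilation_pos _).le,
        Real.log_mul (dilation_pos _).ne' (norm_ne_zero_iff.2 (punctured_ne_zero x)),
        Real.log_zpow] at h2
      change |(k.exponent : ℝ)| ≤ _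
      rw [le_div_iff₀ hla]
      nth_rewrite 1 [← abs_of_pos hla]
      rw [← abs_mul]
      rw [abs_le] at *
      constructor <;> linarith [h1.1, h1.2, h2.1, h2.2]

instance : LocallyCompactSpace (punctured n) := (punctured n).isOpen.locallyCompactSpace

variable (n a) in
/-- The Hopf manifold `(ℂⁿ \ {0}) / ⟨x ↦ a x⟩`, with the quotient topology and the atlas of the
local inverses of the projection. -/
abbrev Hopf := MulAction.orbitRel.Quotient (Dilations a) (punctured n)

variable (a) in
/-- The projection `ℂⁿ \ {0} → Hopf n a`. -/
def hopfProj (x : punctured n) : Hopf n a := Quotient.mk _ x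

theorem hopfProj_eq_iff {x y : punctured n} :
    hopfProj a x = hopfProj a y ↔ ∃ k : Dilations a, k • y = x := Quotient.eq

theorem hopf_isLocalHomeomorph : IsLocalHomeomorph (hopfProj a : punctured n → Hopf n a) :=
  isQuotientCoveringMap_quotientMk_of_properlyDiscontinuousSMul.isCoveringMap.isLocalHomeomorph

instance : IsManifold 𝓘(ℝ, Cn n) ∞ (Hopf n a) := by
  apply isManifold_of_contDiffOn
  have key : ∀ e ∈ atlas (Cn n) (Hopf n a), ∃ s : OpenPartialHomeomorph (Hopf n a) (punctured n),
      s.source = e.source ∧ (∀ z, s.symm z = hopfProj a z) ∧ (∀ q, e q = (s q : Cn n)) := by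
    rintro e ⟨q, rfl⟩
    refine ⟨hopf_isLocalHomeomorph.localInverseAt _, ?_, fun z ↦ ?_, fun q' ↦ rfl⟩
    · ext z
      simp only [TopologicalSpace.Opens.chartAt_eq, OpenPartialHomeomorph.trans_source,
        OpenPartialHomeomorph.subtypeRestr_source, chartAt_self_eq,
        OpenPartialHomeomorph.refl_source, Set.preimage_univ, Set.inter_univ]
      rfl
    · rw [IsLocalHomeomorph.localInverseAt_symm]
  intro e e' he he' y hy
  obtain ⟨s, hs, hs1, hs2⟩ := key e he
  obtain ⟨s', hs', hs1', hs2'⟩ := key e' he'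
  simp only [modelWithCornersSelf_coe, modelWithCornersSelf_coe_symm, Set.preimage_id_eq, id_eq,
    Set.range_id, Set.inter_univ, Function.comp_id, Function.id_comp,
    OpenPartialHomeomorph.coe_trans, OpenPartialHomeomorph.trans_source,
    OpenPartialHomeomorph.symm_source] at hy ⊢
  have hp : e.symm y ∈ s.source := hs ▸ e.map_target hy.1
  have hp' : e.symm y ∈ s'.source := hs' ▸ hy.2
  obtain ⟨k, hk⟩ : ∃ k : Dilations a, k • s (e.symm y) = s' (e.symm y) := by
    apply hopfProj_eq_iff.1
    rw [← hs1 (s _), ← hs1' (s' _)] at *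
    rw [s.left_inv hp, s'.left_inv hp']
  have hcont : ContinuousAt (fun z ↦ k • s (e.symm z)) y :=
    ((s.continuousAt hp).comp (e.symm.continuousAt hy.1)).const_smul k
  have hev : ∀ᶠ z in 𝓝 y, k • s (e.symm z) ∈ s'.target :=
    hcont.eventually_mem (s'.open_target.mem_nhds (hk ▸ s'.map_source hp'))
  have hev2 : ∀ᶠ z in 𝓝 y, z ∈ e.target := e.open_target.mem_nhds hy.1
  refine ContDiffAt.contDiffWithinAt ?_
  have hsm : ContDiffAt ℝ ∞ (fun z : Cn n ↦ a ^ k.exponent • z) y :=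
    contDiffAt_id.const_smul _
  refine hsm.congr_of_eventuallyEq ?_
  filter_upwards [hev, hev2] with z hz hz2
  have hz3 : e.symm z ∈ s.source := hs ▸ e.map_target hz2
  have h1 : hopfProj a (k • s (e.symm z)) = e.symm z := by
    have h2 : hopfProj a (k • s (e.symm z)) = hopfProj a (s (e.symm z)) :=
      hopfProj_eq_iff.2 ⟨k, rfl⟩
    rw [h2, ← hs1, s.left_inv hz3]
  have h3 : s' (e.symm z) = k • s (e.symm z) := by
    have h4 := s'.right_inv hz
    rwa [hs1', h1] at h4
  change e' (e.symm z) = _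
  rw [hs2', h3, coe_dilation_smul, ← hs2, e.right_inv hz2]

/-- `h : (0, ∞) → ℝ` is smooth, non-constant, satisfies `|h| < 1` and `h(a r) = h(r)`; the values
of `h` outside `(0, ∞)` are irrelevant. -/
structure IsRadialProfile (a : ℝ) (h : ℝ → ℝ) : Prop where
  smooth : ContDiffOn ℝ ∞ h (Set.Ioi 0)
  nonconst : ¬ ∃ c : ℝ, ∀ r, 0 < r → h r = c
  abs_lt_one : ∀ r, 0 < r → |h r| < 1
  periodic : ∀ r, 0 < r → h (a * r) = h r

theorem finrank_Cn (hn : 2 ≤ n) : Module.finrank ℝ (Cn n) = 2 * n - 1 + 1 := by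
  rw [← Module.finrank_mul_finrank ℝ ℂ (Cn n), finrank_euclideanSpace_fin,
    Complex.finrank_real_complex]
  omega

end Hopf

end

end LCK

open LCK

/-!
The Lee field `T` of a Vaisman manifold preserves `ω`, so if `|θ| = 1`, contracting `dω = θ ∧ ω`
with `T` gives `d(Jθ) = θ ∧ Jθ - ω`. If `df ∧ θ = 0`, it follows that
`d(f θ ∧ Jθ) = -f θ ∧ d(Jθ) = f θ ∧ ω`, so `ω̄ = ω + f θ ∧ Jθ` satisfies
`dω̄ = (1 + f) θ ∧ ω = (1 + f) θ ∧ ω̄`. Since `ḡ(T, ·) = (1 + f) θ`, the Lee field is still `T`. In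
real dimension at least three the Lee form is determined by the metric, and a parallel form has
constant norm on a connected manifold, whereas `ḡ(T, T) = 1 + f` is not constant.

On the Hopf manifold the charts are local inverses of the projection and differ by dilations, so
the flat connections of the charts agree. This flat connection is the Weyl connection of
`4 r⁻² g_{ℂⁿ}` with Lee form `-2 dr / r`; it determines the Levi-Civita connection, for which the
Lee form is parallel. Polar coordinates `x ↦ (exp (2πi log |x| / log a), x / |x|)` give the
diffeomorphism with `S¹ × S^{2n-1}`.
-/

namespace LCK

open Bundle

noncomputable section

/-! ### Smooth tensor fields in local trivializations -/

section SmoothTensors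

variable {E : Type*} [NormedAddCommGroup E] [NormedSpace ℝ E]
  {M : Type*} [TopologicalSpace M] [ChartedSpace E M] [IsManifold 𝓘(ℝ, E) ∞ M]
  {α β : Form1 E M} {B B' : Form2 E M} {f : M → ℝ}

/-- The isomorphism `E → T_x M` given by the trivialization of the tangent bundle around `x₀`
(zero when `x` is outside the chart domain of `x₀`). -/
abbrev frame (x₀ x : M) : E →L[ℝ] TangentSpace 𝓘(ℝ, E) x :=
  (trivializationAt E (TangentSpace 𝓘(ℝ, E)) x₀).symmL ℝ x

/-- The inverse `T_x M → E` of `frame x₀ x` (zero when `x` is outside the chart domain of `x₀`). -/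
abbrev coframe (x₀ x : M) : TangentSpace 𝓘(ℝ, E) x →L[ℝ] E :=
  (trivializationAt E (TangentSpace 𝓘(ℝ, E)) x₀).continuousLinearMapAt ℝ x

theorem frame_coframe {x₀ x : M} (hx : x ∈ (chartAt E x₀).source) (v : TangentSpace 𝓘(ℝ, E) x) :
    frame x₀ x (coframe x₀ x v) = v :=
  Trivialization.symmL_continuousLinearMapAt _ hx v

theorem coframe_frame {x₀ x : M} (hx : x ∈ (chartAt E x₀).source) (v : E) :
    coframe x₀ x (frame x₀ x v) = v :=
  Trivialization.continuousLinearMapAt_symmL _ hx v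

/-- Smooth endomorphism fields, as in `ComplexStructure.smooth`. -/
def SmoothEnd (A : EndField E M) : Prop :=
  ContMDiff 𝓘(ℝ, E) (𝓘(ℝ, E).prod 𝓘(ℝ, E →L[ℝ] E)) ∞
    (fun x ↦ TotalSpace.mk' (E →L[ℝ] E)
      (E := fun x : M ↦ TangentSpace 𝓘(ℝ, E) x →L[ℝ] TangentSpace 𝓘(ℝ, E) x) x (A x))

/-- Smooth bilinear forms, as in `ContMDiffRiemannianMetric.contMDiff`. -/
def SmoothForm2 (B : Form2 E M) : Prop :=
  ContMDiff 𝓘(ℝ, E) (𝓘(ℝ, E).prod 𝓘(ℝ, E →L[ℝ] E →L[ℝ] ℝ)) ∞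
    (fun x ↦ TotalSpace.mk' (E →L[ℝ] E →L[ℝ] ℝ)
      (E := fun x : M ↦ TangentSpace 𝓘(ℝ, E) x →L[ℝ] TangentSpace 𝓘(ℝ, E) x →L[ℝ] ℝ) x (B x))

theorem smoothVField_iff {X : VField E M} :
    SmoothVField X ↔ ∀ x₀ : M, ContMDiffAt 𝓘(ℝ, E) 𝓘(ℝ, E) ∞
      (fun x ↦ coframe x₀ x (X x)) x₀ := by
  refine forall_congr' fun x₀ ↦ ?_
  rw [contMDiffAt_section]
  apply Filter.EventuallyEq.contMDiffAt_iff
  filter_upwards [chart_source_mem_nhds E x₀] with x hx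
  rw [Trivialization.continuousLinearMapAt_apply, Trivialization.coe_linearMapAt_of_mem _ hx]

theorem smoothForm1_iff :
    SmoothForm1 α ↔ ∀ x₀ : M, ContMDiffAt 𝓘(ℝ, E) 𝓘(ℝ, E →L[ℝ] ℝ) ∞
      (fun x ↦ (α x).comp (frame x₀ x)) x₀ := by
  refine forall_congr' fun x₀ ↦ ?_
  rw [contMDiffAt_section]
  apply Filter.EventuallyEq.contMDiffAt_iff
  filter_upwards [] with x
  ext v
  simp [hom_trivializationAt_apply, ContinuousLinearMap.inCoordinates]

theorem smoothEnd_iff {A : EndField E M} :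
    SmoothEnd A ↔ ∀ x₀ : M, ContMDiffAt 𝓘(ℝ, E) 𝓘(ℝ, E →L[ℝ] E) ∞
      (fun x ↦ (coframe x₀ x).comp ((A x).comp (frame x₀ x))) x₀ := by
  refine forall_congr' fun x₀ ↦ ?_
  rw [contMDiffAt_section]
  apply Filter.EventuallyEq.contMDiffAt_iff
  filter_upwards [] with x
  simp [hom_trivializationAt_apply, ContinuousLinearMap.inCoordinates]

/-- The bilinear form `B` at `x`, read in the trivialization of the tangent bundle around `x₀`. -/
def coordForm2 (B : Form2 E M) (x₀ x : M) : E →L[ℝ] E →L[ℝ] ℝ :=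
  (ContinuousLinearMap.precomp ℝ (frame x₀ x)).comp ((B x).comp (frame x₀ x))

theorem coordForm2_apply (B : Form2 E M) (x₀ x : M) (v w : E) :
    coordForm2 B x₀ x v w = B x (frame x₀ x v) (frame x₀ x w) := rfl

theorem smoothForm2_iff :
    SmoothForm2 B ↔ ∀ x₀ : M, ContMDiffAt 𝓘(ℝ, E) 𝓘(ℝ, E →L[ℝ] E →L[ℝ] ℝ) ∞
      (coordForm2 B x₀) x₀ := by
  refine forall_congr' fun x₀ ↦ ?_
  rw [contMDiffAt_section]
  apply Filter.EventuallyEq.contMDiffAt_iff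
  filter_upwards [chart_source_mem_nhds E x₀] with x hx
  ext v w
  rw [hom_trivializationAt_apply]
  simp only [ContinuousLinearMap.inCoordinates]
  rw [ContinuousLinearMap.comp_apply, ContinuousLinearMap.comp_apply,
    Trivialization.continuousLinearMapAt_apply,
    Trivialization.coe_linearMapAt_of_mem _ (by exact ⟨hx, trivial⟩)]
  refine (DFunLike.congr_fun (congrArg Prod.snd (hom_trivializationAt_apply (RingHom.id ℝ)
    (E₁ := fun x : M ↦ TangentSpace 𝓘(ℝ, E) x) (E₂ := Bundle.Trivial M ℝ) x₀
    ⟨x, B x (frame x₀ x v)⟩)) w).trans ?_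
  simp [ContinuousLinearMap.inCoordinates, coordForm2_apply]

theorem SmoothForm1.smul (hf : ContMDiff 𝓘(ℝ, E) 𝓘(ℝ, ℝ) ∞ f) (hα : SmoothForm1 α) :
    SmoothForm1 (fun x ↦ f x • α x) := by
  rw [smoothForm1_iff] at hα ⊢
  exact fun x₀ ↦ (hf x₀).smul (hα x₀)

theorem SmoothForm1.onForm (J : ComplexStructure E M) (hα : SmoothForm1 α) :
    SmoothForm1 (J.onForm α) := by
  rw [smoothForm1_iff] at hα ⊢
  intro x₀
  refine ((hα x₀).clm_comp (smoothEnd_iff.1 J.smooth x₀)).neg.congr_of_eventuallyEq ?_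
  filter_upwards [chart_source_mem_nhds E x₀] with x hx
  ext v
  change -α x (J x (frame x₀ x v)) = -α x (frame x₀ x (coframe x₀ x (J x (frame x₀ x v))))
  rw [frame_coframe hx]

theorem SmoothForm1.smulRight (hα : SmoothForm1 α) (hβ : SmoothForm1 β) :
    SmoothForm2 (fun x ↦ (α x).smulRight (β x)) := by
  rw [smoothForm1_iff] at hα hβ
  rw [smoothForm2_iff]
  intro x₀
  have hsmul : ContDiff ℝ ∞ fun p : (E →L[ℝ] ℝ) × (E →L[ℝ] ℝ) ↦ p.1.smulRight p.2 :=
    contDiff_fst.smulRight contDiff_snd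
  exact hsmul.contMDiff.contMDiffAt.comp x₀ ((hα x₀).prodMk_space (hβ x₀))

theorem SmoothForm2.add (hB : SmoothForm2 B) (hB' : SmoothForm2 B') :
    SmoothForm2 (fun x ↦ B x + B' x) := by
  rw [smoothForm2_iff] at hB hB' ⊢
  refine fun x₀ ↦ ((hB x₀).add (hB' x₀)).congr_of_eventuallyEq (.of_forall fun x ↦ ?_)
  ext v w
  rfl

theorem SmoothForm2.sub (hB : SmoothForm2 B) (hB' : SmoothForm2 B') :
    SmoothForm2 (fun x ↦ B x - B' x) := by
  rw [smoothForm2_iff] at hB hB' ⊢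
  refine fun x₀ ↦ ((hB x₀).sub (hB' x₀)).congr_of_eventuallyEq (.of_forall fun x ↦ ?_)
  ext v w
  rfl

theorem SmoothForm2.smul (hf : ContMDiff 𝓘(ℝ, E) 𝓘(ℝ, ℝ) ∞ f) (hB : SmoothForm2 B) :
    SmoothForm2 (fun x ↦ f x • B x) := by
  rw [smoothForm2_iff] at hB ⊢
  refine fun x₀ ↦ ((hf x₀).smul (hB x₀)).congr_of_eventuallyEq (.of_forall fun x ↦ ?_)
  ext v w
  rfl

theorem SmoothForm1.wedge (hα : SmoothForm1 α) (hβ : SmoothForm1 β) :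
    SmoothForm2 (wedge α β) :=
  (hα.smulRight hβ).sub (hβ.smulRight hα)

theorem smoothForm2_fundamentalForm (J : ComplexStructure E M) (g : RMetric E M) :
    SmoothForm2 (fundamentalForm J g) := by
  rw [smoothForm2_iff]
  intro x₀
  have hcoord := (smoothForm2_iff.1 g.contMDiff x₀).clm_comp (smoothEnd_iff.1 J.smooth x₀)
  refine hcoord.congr_of_eventuallyEq ?_
  filter_upwards [chart_source_mem_nhds E x₀] with x hx
  ext v w
  change g.inner x (J x (frame x₀ x v)) _ =
    g.inner x (frame x₀ x (coframe x₀ x (J x (frame x₀ x v)))) _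
  rw [frame_coframe hx]

theorem SmoothVField.diffAt {X : VField E M} (hX : SmoothVField X) (x : M) : DiffAt X x :=
  (hX x).mdifferentiableAt (by simp)

theorem ComplexStructure.diffAt (J : ComplexStructure E M) {X : VField E M}
    {x : M} (hX : DiffAt X x) : DiffAt (fun y ↦ J y (X y)) x :=
  MDifferentiableAt.clm_bundle_apply (b := id)
    ((J.smooth x).mdifferentiableAt (by simp)) hX

theorem SmoothForm1.mdifferentiableAt_apply (hα : SmoothForm1 α) {X : VField E M}
    {x : M} (hX : DiffAt X x) : MDifferentiableAt 𝓘(ℝ, E) 𝓘(ℝ, ℝ) (fun y ↦ α y (X y)) x :=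
  ((mdifferentiableAt_totalSpace _ _).1 <|
    MDifferentiableAt.clm_bundle_apply (F₂ := ℝ) (E₂ := Bundle.Trivial M ℝ) (b := id)
      ((hα x).mdifferentiableAt (by simp)) hX).2

theorem SmoothForm2.mdifferentiableAt_apply (hB : SmoothForm2 B) {X Y : VField E M}
    {x : M} (hX : DiffAt X x) (hY : DiffAt Y x) :
    MDifferentiableAt 𝓘(ℝ, E) 𝓘(ℝ, ℝ) (fun y ↦ B y (X y) (Y y)) x :=
  ((mdifferentiableAt_totalSpace _ _).1 <|
    MDifferentiableAt.clm_bundle_apply₂ (F₃ := ℝ) (E₃ := Bundle.Trivial M ℝ) (b := id)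
      ((hB x).mdifferentiableAt (by simp)) hX hY).2

theorem exists_diffAt_eq (x : M) (v : TangentSpace 𝓘(ℝ, E) x) :
    ∃ X : VField E M, DiffAt X x ∧ X x = v :=
  ⟨FiberBundle.extend E v, FiberBundle.mdifferentiableAt_extend _ _ v,
    FiberBundle.extend_apply_self E v⟩

end SmoothTensors

/-! ### Exterior calculus -/

section ExteriorCalculus

variable {E : Type*} [NormedAddCommGroup E] [NormedSpace ℝ E]
  {M : Type*} [TopologicalSpace M] [ChartedSpace E M] {f h : M → ℝ} {x : M}

theorem diff_add (hf : MDifferentiableAt 𝓘(ℝ, E) 𝓘(ℝ, ℝ) f x)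
    (hh : MDifferentiableAt 𝓘(ℝ, E) 𝓘(ℝ, ℝ) h x) :
    diff (E := E) (fun y ↦ f y + h y) x = diff f x + diff h x := mvfderiv_fun_add hf hh

theorem diff_sub (hf : MDifferentiableAt 𝓘(ℝ, E) 𝓘(ℝ, ℝ) f x)
    (hh : MDifferentiableAt 𝓘(ℝ, E) 𝓘(ℝ, ℝ) h x) :
    diff (E := E) (fun y ↦ f y - h y) x = diff f x - diff h x := mvfderiv_fun_sub hf hh

theorem diff_mul (hf : MDifferentiableAt 𝓘(ℝ, E) 𝓘(ℝ, ℝ) f x)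
    (hh : MDifferentiableAt 𝓘(ℝ, E) 𝓘(ℝ, ℝ) h x) :
    diff (E := E) (fun y ↦ f y * h y) x = f x • diff h x + h x • diff f x :=
  mvfderiv_fun_mul hf hh

theorem diff_neg : diff (E := E) (fun y ↦ -f y) x = -diff f x := mvfderiv_fun_neg

theorem diff_const_add (c : ℝ) (hf : MDifferentiableAt 𝓘(ℝ, E) 𝓘(ℝ, ℝ) f x) :
    diff (E := E) (fun y ↦ c + f y) x = diff f x := by
  rw [diff_add mdifferentiableAt_const hf, show diff (E := E) (fun _ : M ↦ c) x = 0 from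
    mvfderiv_const c, zero_add]

theorem wedge_apply (α β : Form1 E M) (x : M) (v w : TangentSpace 𝓘(ℝ, E) x) :
    wedge α β x v w = α x v * β x w - β x v * α x w := rfl

variable [IsManifold 𝓘(ℝ, E) ∞ M] {α β : Form1 E M} {η η' : Form2 E M} {X Y Z : VField E M}

theorem extDeriv1_smul (hf : MDifferentiableAt 𝓘(ℝ, E) 𝓘(ℝ, ℝ) f x) (hα : SmoothForm1 α)
    (hX : DiffAt X x) (hY : DiffAt Y x) :
    extDeriv1 (fun y ↦ f y • α y) X Y x =
      wedge (diff f) α x (X x) (Y x) + f x * extDeriv1 α X Y x := by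
  simp only [extDeriv1, wedge_apply, smul_apply, smul_eq_mul,
    diff_mul hf (hα.mdifferentiableAt_apply hX), diff_mul hf (hα.mdifferentiableAt_apply hY),
    add_apply]
  ring

theorem extDeriv2_add (hη : SmoothForm2 η) (hη' : SmoothForm2 η')
    (hX : DiffAt X x) (hY : DiffAt Y x) (hZ : DiffAt Z x) :
    extDeriv2 (fun y ↦ η y + η' y) X Y Z x = extDeriv2 η X Y Z x + extDeriv2 η' X Y Z x := by
  simp only [extDeriv2, add_apply,
    diff_add (hη.mdifferentiableAt_apply hY hZ) (hη'.mdifferentiableAt_apply hY hZ),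
    diff_add (hη.mdifferentiableAt_apply hX hZ) (hη'.mdifferentiableAt_apply hX hZ),
    diff_add (hη.mdifferentiableAt_apply hX hY) (hη'.mdifferentiableAt_apply hX hY)]
  ring

theorem extDeriv2_smul (hf : MDifferentiableAt 𝓘(ℝ, E) 𝓘(ℝ, ℝ) f x) (hη : SmoothForm2 η)
    (hX : DiffAt X x) (hY : DiffAt Y x) (hZ : DiffAt Z x) :
    extDeriv2 (fun y ↦ f y • η y) X Y Z x =
      wedge12 (diff f) η x (X x) (Y x) (Z x) + f x * extDeriv2 η X Y Z x := by
  simp only [extDeriv2, wedge12, smul_apply, smul_eq_mul, add_apply,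
    diff_mul hf (hη.mdifferentiableAt_apply hY hZ),
    diff_mul hf (hη.mdifferentiableAt_apply hX hZ),
    diff_mul hf (hη.mdifferentiableAt_apply hX hY)]
  ring

theorem diff_wedge_apply (hα : SmoothForm1 α) (hβ : SmoothForm1 β) (hX : DiffAt X x)
    (hY : DiffAt Y x) :
    diff (E := E) (fun y ↦ wedge α β y (X y) (Y y)) x =
      β x (Y x) • diff (E := E) (fun y ↦ α y (X y)) x
      + α x (X x) • diff (E := E) (fun y ↦ β y (Y y)) x
      - (α x (Y x) • diff (E := E) (fun y ↦ β y (X y)) x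
        + β x (X x) • diff (E := E) (fun y ↦ α y (Y y)) x) := by
  have hαX := hα.mdifferentiableAt_apply hX
  have hαY := hα.mdifferentiableAt_apply hY
  have hβX := hβ.mdifferentiableAt_apply hX
  have hβY := hβ.mdifferentiableAt_apply hY
  have hαβ : MDifferentiableAt 𝓘(ℝ, E) 𝓘(ℝ, ℝ) (fun y ↦ α y (X y) * β y (Y y)) x := hαX.mul hβY
  have hβα : MDifferentiableAt 𝓘(ℝ, E) 𝓘(ℝ, ℝ) (fun y ↦ β y (X y) * α y (Y y)) x := hβX.mul hαY
  simp only [wedge_apply]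
  rw [diff_sub hαβ hβα, diff_mul hαX hβY, diff_mul hβX hαY,
    add_comm (α x (X x) • _), add_comm (β x (X x) • _)]

theorem extDeriv2_wedge (hα : SmoothForm1 α) (hβ : SmoothForm1 β)
    (hX : DiffAt X x) (hY : DiffAt Y x) (hZ : DiffAt Z x) :
    extDeriv2 (wedge α β) X Y Z x =
      extDeriv1 α X Y x * β x (Z x) - extDeriv1 α X Z x * β x (Y x) + extDeriv1 α Y Z x * β x (X x)
      - (α x (X x) * extDeriv1 β Y Z x - α x (Y x) * extDeriv1 β X Z x
        + α x (Z x) * extDeriv1 β X Y x) := by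
  simp only [extDeriv2, extDeriv1, diff_wedge_apply hα hβ hY hZ, diff_wedge_apply hα hβ hX hZ,
    diff_wedge_apply hα hβ hX hY]
  simp only [wedge_apply, add_apply, sub_apply, smul_apply, smul_eq_mul]
  ring

theorem Closed1.smul (hα : SmoothForm1 α) (hclosed : Closed1 α)
    (hf : ContMDiff 𝓘(ℝ, E) 𝓘(ℝ, ℝ) ∞ f) (hw : ∀ x, wedge (diff f) α x = 0) :
    Closed1 (fun x ↦ f x • α x) := by
  intro x X Y hX hY
  rw [extDeriv1_smul ((hf x).mdifferentiableAt (by simp)) hα hX hY, hclosed x X Y hX hY, hw x]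
  simp

end ExteriorCalculus

/-! ### Metric duality -/

section PositiveDefinite

variable {E : Type*} [NormedAddCommGroup E] [NormedSpace ℝ E] [FiniteDimensional ℝ E]
  {B : E →L[ℝ] E →L[ℝ] ℝ}

theorem exists_continuousLinearEquiv_of_pos (hB : ∀ v, v ≠ 0 → 0 < B v v) :
    ∃ e : E ≃L[ℝ] (E →L[ℝ] ℝ), (e : E →L[ℝ] E →L[ℝ] ℝ) = B := by
  have hinj : Function.Injective B := by
    rw [injective_iff_map_eq_zero]
    intro v hv
    by_contra hne
    exact (hB v hne).ne' (DFunLike.congr_fun hv v)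
  have hfin : Module.finrank ℝ E = Module.finrank ℝ (E →L[ℝ] ℝ) := by
    rw [← (LinearMap.toContinuousLinearMap : (E →ₗ[ℝ] ℝ) ≃ₗ[ℝ] _).finrank_eq]
    exact (Subspace.dual_finrank_eq (K := ℝ)).symm
  exact ⟨(LinearEquiv.ofInjectiveOfFinrankEq B.toLinearMap hinj hfin).toContinuousLinearEquiv, rfl⟩

theorem isCoercive_of_pos (hB : ∀ v, v ≠ 0 → 0 < B v v) : IsCoercive B := by
  obtain hsub | hnontriv := subsingleton_or_nontrivial E
  · exact ⟨1, one_pos, fun v ↦ by simp [Subsingleton.elim v 0]⟩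
  have hcont : Continuous fun v : E ↦ B v v := by fun_prop
  obtain ⟨m, hm, hmin⟩ := (isCompact_sphere (0 : E) 1).exists_isMinOn
    (NormedSpace.sphere_nonempty.2 zero_le_one) hcont.continuousOn
  refine ⟨B m m, hB m (ne_zero_of_mem_unit_sphere ⟨m, hm⟩), fun v ↦ ?_⟩
  obtain rfl | hv := eq_or_ne v 0
  · simp
  have hle : B m m ≤ B (‖v‖⁻¹ • v) (‖v‖⁻¹ • v) :=
    hmin (by simp [norm_smul, hv] : ‖v‖⁻¹ • v ∈ Metric.sphere (0 : E) 1)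
  simp only [map_smul, smul_apply, smul_eq_mul] at hle
  calc B m m * ‖v‖ * ‖v‖ ≤ ‖v‖⁻¹ * (‖v‖⁻¹ * B v v) * ‖v‖ * ‖v‖ := by gcongr
    _ = B v v := by field_simp

theorem isVonNBounded_of_pos (hB : ∀ v, v ≠ 0 → 0 < B v v) :
    Bornology.IsVonNBounded ℝ {v : E | B v v < 1} := by
  obtain ⟨C, hC, hcoercive⟩ := isCoercive_of_pos hB
  rw [NormedSpace.isVonNBounded_iff]
  refine (Metric.isBounded_closedBall (x := (0 : E)) (r := √(1 / C))).subset fun v hv ↦ ?_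
  rw [mem_closedBall_zero_iff]
  refine Real.le_sqrt_of_sq_le ((le_div_iff₀ hC).2 ?_)
  calc ‖v‖ ^ 2 * C = C * ‖v‖ * ‖v‖ := by ring
    _ ≤ B v v := hcoercive v
    _ ≤ 1 := (show B v v < 1 from hv).le

end PositiveDefinite

section Sharp

variable {E : Type*} [NormedAddCommGroup E] [NormedSpace ℝ E]
  {M : Type*} [TopologicalSpace M] [ChartedSpace E M] [IsManifold 𝓘(ℝ, E) ∞ M]

theorem RMetric.inner_self_nonneg (g : RMetric E M) (x : M) (v : TangentSpace 𝓘(ℝ, E) x) :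
    0 ≤ g.inner x v v := by
  obtain rfl | hv := eq_or_ne v 0
  · simp
  · exact (g.pos x v hv).le

theorem RMetric.ext_inner_right (g : RMetric E M) {x : M} {v w : TangentSpace 𝓘(ℝ, E) x}
    (h : ∀ u, g.inner x v u = g.inner x w u) : v = w := by
  by_contra hne
  have hpos := g.pos x (v - w) (sub_ne_zero.2 hne)
  rw [(g.inner x).map_sub, sub_apply, h, sub_self] at hpos
  exact lt_irrefl _ hpos

variable [FiniteDimensional ℝ E]

theorem sharp_eq_iff (g : RMetric E M) (α : Form1 E M) {x : M} {v : TangentSpace 𝓘(ℝ, E) x} :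
    sharp g α x = v ↔ ∀ w, g.inner x v w = α x w :=
  ⟨fun h w ↦ h ▸ inner_sharp g α x w,
    fun h ↦ g.ext_inner_right fun w ↦ by rw [inner_sharp, h]⟩

theorem fnorm_eq_one_iff {g : RMetric E M} {α : Form1 E M} {x : M} :
    fnorm g α x = 1 ↔ α x (sharp g α x) = 1 := by
  rw [fnorm, vnorm, Real.sqrt_eq_one, inner_sharp]

theorem RMetric.exists_continuousLinearEquiv_coordForm2 (g : RMetric E M) {x₀ x : M}
    (hx : x ∈ (chartAt E x₀).source) :
    ∃ e : E ≃L[ℝ] (E →L[ℝ] ℝ), (e : E →L[ℝ] E →L[ℝ] ℝ) = coordForm2 g.inner x₀ x := by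
  refine exists_continuousLinearEquiv_of_pos fun v hv ↦
    g.pos x _ fun (hzero : frame x₀ x v = 0) ↦ hv ?_
  rw [← coframe_frame hx v, hzero, map_zero]

theorem SmoothForm1.sharp (g : RMetric E M) {α : Form1 E M} (hα : SmoothForm1 α) :
    SmoothVField (sharp g α) := by
  rw [smoothVField_iff]
  intro x₀
  have hinv : ContMDiffAt 𝓘(ℝ, E) 𝓘(ℝ, (E →L[ℝ] ℝ) →L[ℝ] E) ∞
      (fun x ↦ ContinuousLinearMap.inverse (coordForm2 g.inner x₀ x)) x₀ := by
    obtain ⟨e, he⟩ := g.exists_continuousLinearEquiv_coordForm2 (mem_chart_source E x₀)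
    have hinverse := contDiffAt_map_inverse (n := ∞) e
    rw [he] at hinverse
    exact hinverse.contMDiffAt.comp x₀ (smoothForm2_iff.1 g.contMDiff x₀)
  refine (hinv.clm_apply (smoothForm1_iff.1 hα x₀)).congr_of_eventuallyEq ?_
  filter_upwards [chart_source_mem_nhds E x₀] with x hx
  obtain ⟨e, he⟩ := g.exists_continuousLinearEquiv_coordForm2 hx
  have he_apply (v w : E) : e v w = g.inner x (frame x₀ x v) (frame x₀ x w) :=
    DFunLike.congr_fun (DFunLike.congr_fun he v) w
  rw [← he, ContinuousLinearMap.inverse_equiv]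
  refine (e.symm_apply_eq.2 ?_).symm
  ext w
  rw [he_apply, frame_coframe hx, inner_sharp, ContinuousLinearMap.comp_apply]

end Sharp

/-! ### Hermitian metrics and the Levi-Civita connection -/

section LeviCivita

variable {E : Type*} [NormedAddCommGroup E] [NormedSpace ℝ E]
  {M : Type*} [TopologicalSpace M] [ChartedSpace E M] [IsManifold 𝓘(ℝ, E) ∞ M]
  {J : ComplexStructure E M} {g : RMetric E M}
  {D : CovariantDerivative 𝓘(ℝ, E) E (fun x : M ↦ TangentSpace 𝓘(ℝ, E) x)}
  {x : M} {X Y Z : VField E M}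

theorem onForm_apply (J : ComplexStructure E M) (α : Form1 E M) (x : M)
    (v : TangentSpace 𝓘(ℝ, E) x) : J.onForm α x v = -α x (J x v) := rfl

theorem fundamentalForm_apply (x : M) (v w : TangentSpace 𝓘(ℝ, E) x) :
    fundamentalForm J g x v w = g.inner x (J x v) w := rfl

theorem IsHermitian.inner_left (h : IsHermitian J g) (x : M) (v w : TangentSpace 𝓘(ℝ, E) x) :
    g.inner x (J x v) w = -g.inner x v (J x w) := by
  rw [← h x v (J x w), J.sq, map_neg, neg_neg]

theorem IsHermitian.fundamentalForm_swap (h : IsHermitian J g) (x : M)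
    (v w : TangentSpace 𝓘(ℝ, E) x) :
    fundamentalForm J g x v w = -fundamentalForm J g x w v := by
  rw [fundamentalForm_apply, fundamentalForm_apply, h.inner_left, g.symm]

theorem IsHermitian.inner_J_self (h : IsHermitian J g) (x : M) (v : TangentSpace 𝓘(ℝ, E) x) :
    g.inner x (J x v) v = 0 :=
  self_eq_neg.1 (h.fundamentalForm_swap x v v)

theorem covariantDerivative_neg (hY : DiffAt Y x) : D (fun y ↦ -Y y) x = -D Y x := by
  have hneg : (fun y ↦ -Y y : VField E M) = (-1 : ℝ) • Y := (neg_one_smul ℝ Y).symm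
  rw [hneg, D.isCovariantDerivativeOn.smul_const (-1 : ℝ) hY, neg_one_smul]

variable (J D) in
/-- The covariant derivative of `J`: `covJ J D Y x v` is `(∇_v J) Y = ∇_v (J Y) - J (∇_v Y)`. -/
def covJ (Y : VField E M) (x : M) (v : TangentSpace 𝓘(ℝ, E) x) : TangentSpace 𝓘(ℝ, E) x :=
  D (fun y ↦ J y (Y y)) x v - J x (D Y x v)

theorem covJ_comp_J (hY : DiffAt Y x) (v : TangentSpace 𝓘(ℝ, E) x) :
    covJ J D (fun y ↦ J y (Y y)) x v = -J x (covJ J D Y x v) := by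
  simp only [covJ, J.sq]
  rw [covariantDerivative_neg hY, map_sub, J.sq, neg_apply]
  abel

theorem IsLeviCivita.diff_fundamentalForm (hD : IsLeviCivita g D) (hY : DiffAt Y x)
    (hZ : DiffAt Z x) (v : TangentSpace 𝓘(ℝ, E) x) :
    diff (fun y ↦ fundamentalForm J g y (Y y) (Z y)) x v =
      g.inner x (covJ J D Y x v) (Z x) + fundamentalForm J g x (D Y x v) (Z x)
        + fundamentalForm J g x (Y x) (D Z x v) := by
  simp only [fundamentalForm_apply, hD.metric x v _ _ (J.diffAt hY) hZ, covJ, map_sub, sub_apply,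
    sub_add_cancel]

theorem IsLeviCivita.inner_covJ_swap (hD : IsLeviCivita g D) (hg : IsHermitian J g)
    (hY : DiffAt Y x) (hZ : DiffAt Z x) (v : TangentSpace 𝓘(ℝ, E) x) :
    g.inner x (covJ J D Y x v) (Z x) = -g.inner x (covJ J D Z x v) (Y x) := by
  have hYZ := hD.diff_fundamentalForm (J := J) hY hZ v
  have hZY := hD.diff_fundamentalForm (J := J) hZ hY v
  simp only [hg.fundamentalForm_swap _ (Y _)] at hYZ
  rw [diff_neg, neg_apply, hZY] at hYZ
  rw [hg.fundamentalForm_swap x (D Y x v)] at hYZ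
  linarith

theorem IsHermitian.inner_covJ_comp_J (hg : IsHermitian J g) (hY : DiffAt Y x)
    (v w : TangentSpace 𝓘(ℝ, E) x) :
    g.inner x (covJ J D (fun y ↦ J y (Y y)) x v) w = g.inner x (covJ J D Y x v) (J x w) := by
  rw [covJ_comp_J hY, map_neg, neg_apply, hg.inner_left, neg_neg]

theorem IsLeviCivita.extDeriv2_fundamentalForm (hD : IsLeviCivita g D) (hg : IsHermitian J g)
    (hX : DiffAt X x) (hY : DiffAt Y x) (hZ : DiffAt Z x) :
    extDeriv2 (fundamentalForm J g) X Y Z x = g.inner x (covJ J D Y x (X x)) (Z x)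
      + g.inner x (covJ J D Z x (Y x)) (X x) + g.inner x (covJ J D X x (Z x)) (Y x) := by
  simp only [extDeriv2, ← hD.torsion_free x X Y hX hY, ← hD.torsion_free x X Z hX hZ,
    ← hD.torsion_free x Y Z hY hZ, hD.diff_fundamentalForm hY hZ, hD.diff_fundamentalForm hX hZ,
    hD.diff_fundamentalForm hX hY, map_sub, sub_apply]
  rw [hg.fundamentalForm_swap x (Y x), hg.fundamentalForm_swap x (X x) (D Y x _),
    hg.fundamentalForm_swap x (X x) (D Z x _), hD.inner_covJ_swap hg hX hZ]
  ring

theorem IsLeviCivita.covJ_nijenhuis (hD : IsLeviCivita g D) (hX : DiffAt X x) (hY : DiffAt Y x) :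
    covJ J D Y x (J x (X x)) - covJ J D X x (J x (Y x))
      + J x (covJ J D X x (Y x)) - J x (covJ J D Y x (X x)) = 0 := by
  rw [← J.nijenhuis x X Y hX hY, ← hD.torsion_free x _ _ (J.diffAt hX) (J.diffAt hY),
    ← hD.torsion_free x _ _ (J.diffAt hX) hY, ← hD.torsion_free x _ _ hX (J.diffAt hY),
    ← hD.torsion_free x _ _ hX hY]
  simp only [covJ, map_sub, J.sq]
  abel

theorem IsLeviCivita.two_mul_inner_covJ (hD : IsLeviCivita g D) (hg : IsHermitian J g)
    (hX : DiffAt X x) (hY : DiffAt Y x) (hZ : DiffAt Z x) :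
    2 * g.inner x (covJ J D Y x (X x)) (Z x) = extDeriv2 (fundamentalForm J g) X Y Z x
      - extDeriv2 (fundamentalForm J g) X (fun y ↦ J y (Y y)) (fun y ↦ J y (Z y)) x := by
  have hN := congrArg (fun u ↦ g.inner x u (J x (X x))) (hD.covJ_nijenhuis (J := J) hY hZ)
  simp only [map_add, map_sub, add_apply, sub_apply, map_zero, zero_apply] at hN
  rw [hg x, hg x] at hN
  have hYJZ : g.inner x (covJ J D (fun y ↦ J y (Y y)) x (X x)) (J x (Z x)) =
      -g.inner x (covJ J D Y x (X x)) (Z x) := by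
    rw [hg.inner_covJ_comp_J hY, J.sq, map_neg]
  rw [hD.extDeriv2_fundamentalForm hg hX hY hZ,
    hD.extDeriv2_fundamentalForm hg hX (J.diffAt hY) (J.diffAt hZ), hYJZ,
    hg.inner_covJ_comp_J hZ, hD.inner_covJ_swap hg hX (J.diffAt hY), hg.inner_covJ_comp_J hY,
    hD.inner_covJ_swap hg hX hY]
  linarith

theorem IsLeviCivita.bracket_of_parallel (hD : IsLeviCivita g D)
    (hX : DiffAt X x) (hDX : D X x = 0) (hY : DiffAt Y x) : bracket X Y x = D Y x (X x) := by
  rw [← hD.torsion_free x X Y hX hY, hDX, zero_apply, sub_zero]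

end LeviCivita

section Vaisman

variable {E : Type*} [NormedAddCommGroup E] [NormedSpace ℝ E] [FiniteDimensional ℝ E]
  {M : Type*} [TopologicalSpace M] [ChartedSpace E M] [IsManifold 𝓘(ℝ, E) ∞ M]
  {J : ComplexStructure E M} {g : RMetric E M} {θ : Form1 E M}
  {D : CovariantDerivative 𝓘(ℝ, E) E (fun x : M ↦ TangentSpace 𝓘(ℝ, E) x)}
  {x : M} {X Y : VField E M}

theorem IsHermitian.fundamentalForm_sharp (hg : IsHermitian J g) (x : M)
    (v : TangentSpace 𝓘(ℝ, E) x) :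
    fundamentalForm J g x (sharp g θ x) v = J.onForm θ x v := by
  rw [fundamentalForm_apply, hg.inner_left, inner_sharp, onForm_apply]

theorem IsHermitian.onForm_sharp (hg : IsHermitian J g) (x : M) :
    J.onForm θ x (sharp g θ x) = 0 := by
  rw [← hg.fundamentalForm_sharp, fundamentalForm_apply, hg.inner_J_self]

theorem IsParallel.exists_isLeviCivita (h : IsParallel g θ) (hθ : SmoothForm1 θ) :
    ∃ D, IsLeviCivita g D ∧ ∀ x, D (sharp g θ) x = 0 := by
  obtain ⟨D, hD, hparallel⟩ := h
  refine ⟨D, hD, fun x ↦ ContinuousLinearMap.ext fun v ↦ g.ext_inner_right fun u ↦ ?_⟩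
  obtain ⟨Y, hY, rfl⟩ := exists_diffAt_eq x u
  have hmetric := hD.metric x v _ _ ((hθ.sharp g).diffAt x) hY
  simp only [inner_sharp] at hmetric
  simp only [zero_apply, map_zero]
  linarith [hparallel x v Y hY]

theorem IsParallel.diff_apply_sharp (h : IsParallel g θ) (hθ : SmoothForm1 θ) (x : M) :
    diff (E := E) (fun y ↦ θ y (sharp g θ y)) x = 0 := by
  obtain ⟨D, hD, hDT⟩ := h.exists_isLeviCivita hθ
  have hT := (hθ.sharp g).diffAt x
  ext v
  simp only [← inner_sharp g θ, hD.metric x v _ _ hT hT, hDT, zero_apply, map_zero, add_zero]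

theorem IsLCKWith.covJ_sharp (h : IsLCKWith J g θ) (hD : IsLeviCivita g D) (hY : DiffAt Y x) :
    covJ J D Y x (sharp g θ x) = 0 := by
  have hg := h.hermitian
  refine g.ext_inner_right fun u ↦ ?_
  obtain ⟨Z, hZ, rfl⟩ := exists_diffAt_eq x u
  have hT := (h.smooth.sharp g).diffAt x
  have hcov := hD.two_mul_inner_covJ hg hT hY hZ
  rw [h.lee x _ _ _ hT hY hZ, h.lee x _ _ _ hT (J.diffAt hY) (J.diffAt hZ)] at hcov
  simp only [wedge12, hg.fundamentalForm_sharp, onForm_apply, fundamentalForm_apply,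
    J.sq, map_neg, neg_apply] at hcov
  rw [hg.inner_left x (Y x) (Z x)] at hcov
  rw [map_zero, zero_apply]
  linarith

theorem IsVaismanWith.isHolomorphic_sharp (h : IsVaismanWith J g θ) :
    IsHolomorphic J (sharp g θ) := by
  obtain ⟨D, hD, hDT⟩ := h.2.exists_isLeviCivita h.1.smooth
  have hT := h.1.smooth.sharp g
  refine ⟨hT, fun x Y hY ↦ ?_⟩
  rw [hD.bracket_of_parallel (hT.diffAt x) (hDT x) (J.diffAt hY),
    hD.bracket_of_parallel (hT.diffAt x) (hDT x) hY]
  exact sub_eq_zero.1 (h.1.covJ_sharp hD hY)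

theorem IsVaismanWith.diff_fundamentalForm_sharp (h : IsVaismanWith J g θ) (hX : DiffAt X x)
    (hY : DiffAt Y x) :
    diff (fun y ↦ fundamentalForm J g y (X y) (Y y)) x (sharp g θ x) =
      fundamentalForm J g x (bracket (sharp g θ) X x) (Y x)
        + fundamentalForm J g x (X x) (bracket (sharp g θ) Y x) := by
  obtain ⟨D, hD, hDT⟩ := h.2.exists_isLeviCivita h.1.smooth
  have hT := (h.1.smooth.sharp g).diffAt x
  rw [hD.diff_fundamentalForm hX hY, h.1.covJ_sharp hD hX, map_zero, zero_apply, zero_add,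
    hD.bracket_of_parallel hT (hDT x) hX, hD.bracket_of_parallel hT (hDT x) hY]

-- Cartan's formula: since `𝓛_T ω = 0` and `ι_T ω = Jθ`, contracting `dω = θ ∧ ω` with `T` gives
-- `-d(Jθ) = θ(T) ω - θ ∧ Jθ`.
theorem IsVaismanWith.extDeriv1_onForm (h : IsVaismanWith J g θ)
    (hn : θ x (sharp g θ x) = 1) (hX : DiffAt X x) (hY : DiffAt Y x) :
    extDeriv1 (J.onForm θ) X Y x =
      wedge θ (J.onForm θ) x (X x) (Y x) - fundamentalForm J g x (X x) (Y x) := by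
  have hg := h.1.hermitian
  have hlee := h.1.lee x _ _ _ ((h.1.smooth.sharp g).diffAt x) hX hY
  simp only [extDeriv2, wedge12, h.diff_fundamentalForm_sharp hX hY, hg.fundamentalForm_sharp,
    hg.fundamentalForm_swap x _ (sharp g θ x), hg.fundamentalForm_swap x _ (X x), hn] at hlee
  rw [extDeriv1, wedge_apply]
  linarith

end Vaisman

/-! ### The deformed metric -/

section Deformation

variable {E : Type*} [NormedAddCommGroup E] [NormedSpace ℝ E]
  {M : Type*} [TopologicalSpace M] [ChartedSpace E M] [IsManifold 𝓘(ℝ, E) ∞ M]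
  {J : ComplexStructure E M} {g : RMetric E M} {θ : Form1 E M} {f : M → ℝ}

theorem deformedForm_apply_J (hg : IsHermitian J g) (x : M) (v w : TangentSpace 𝓘(ℝ, E) x) :
    deformedForm J g θ f x v (J x w) = g.inner x v w
      + f x * (θ x v * θ x w + J.onForm θ x v * J.onForm θ x w) := by
  change fundamentalForm J g x v (J x w) + f x * wedge θ (J.onForm θ) x v (J x w) = _
  simp only [fundamentalForm_apply, hg x, wedge_apply, onForm_apply, J.sq, map_neg]
  ring

variable [FiniteDimensional ℝ E]

-- Bessel's inequality for the orthonormal pair `T`, `JT`.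
theorem IsHermitian.sq_add_sq_onForm_le (hg : IsHermitian J g) {x : M}
    (hunit : θ x (sharp g θ x) = 1) (v : TangentSpace 𝓘(ℝ, E) x) :
    θ x v ^ 2 + J.onForm θ x v ^ 2 ≤ g.inner x v v := by
  set T := sharp g θ x
  have hT (w) : g.inner x T w = θ x w := inner_sharp g θ x w
  have hJT (w) : g.inner x (J x T) w = J.onForm θ x w := hg.fundamentalForm_sharp x w
  have hJTT : J.onForm θ x T = 0 := hg.onForm_sharp x
  have hTJT : θ x (J x T) = 0 := by rw [← hT, g.symm, hJT, hJTT]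
  have hJTJT : J.onForm θ x (J x T) = 1 := by rw [← hJT, hg, hT, hunit]
  have hnonneg := g.inner_self_nonneg x (v - θ x v • T - J.onForm θ x v • J x T)
  simp only [map_sub, sub_apply, map_smul, smul_apply, smul_eq_mul, hT, hJT, hunit, hJTT, hTJT,
    hJTJT, g.symm x v T, g.symm x v (J x T)] at hnonneg
  linarith

theorem IsHermitian.inner_add_mul_sq_add_sq_pos (hg : IsHermitian J g) {x : M}
    (hunit : θ x (sharp g θ x) = 1) {c : ℝ} (hc : -1 < c) {v : TangentSpace 𝓘(ℝ, E) x}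
    (hv : v ≠ 0) : 0 < g.inner x v v + c * (θ x v * θ x v + J.onForm θ x v * J.onForm θ x v) := by
  have hbessel := hg.sq_add_sq_onForm_le hunit v
  have hpos := g.pos x v hv
  obtain hc0 | hc0 := le_or_gt 0 c
  · exact add_pos_of_pos_of_nonneg hpos
      (mul_nonneg hc0 (add_nonneg (mul_self_nonneg _) (mul_self_nonneg _)))
  · linarith [mul_le_mul_of_nonpos_left hbessel hc0.le, mul_pos (neg_lt_iff_pos_add.1 hc) hpos]

variable (J g θ f) in
/-- The metric `g + f (θ ⊗ θ + Jθ ⊗ Jθ)`, which is `ω̄(·, J ·)` for the deformed form `ω̄`. The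
unit length of `θ` is expressed as `θ(T) = 1` for `T = θ♯`. -/
def deformedMetric (hg : IsHermitian J g) (hθ : SmoothForm1 θ)
    (hunit : ∀ x, θ x (sharp g θ x) = 1) (hf : ContMDiff 𝓘(ℝ, E) 𝓘(ℝ, ℝ) ∞ f)
    (hf1 : ∀ x, -1 < f x) : RMetric E M where
  inner x := g.inner x + f x • ((θ x).smulRight (θ x) + (J.onForm θ x).smulRight (J.onForm θ x))
  symm x v w := by
    simp only [add_apply, smul_apply, ContinuousLinearMap.smulRight_apply, smul_eq_mul,
      g.symm x v w]
    ring
  pos x v hv := hg.inner_add_mul_sq_add_sq_pos (hunit x) (hf1 x) hv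
  isVonNBounded x := isVonNBounded_of_pos (E := E) fun v hv ↦
    hg.inner_add_mul_sq_add_sq_pos (hunit x) (hf1 x) hv
  contMDiff := SmoothForm2.add g.contMDiff <|
    SmoothForm2.smul hf ((hθ.smulRight hθ).add ((hθ.onForm J).smulRight (hθ.onForm J)))

section

variable (hg : IsHermitian J g) (hθ : SmoothForm1 θ) (hunit : ∀ x, θ x (sharp g θ x) = 1)
  (hf : ContMDiff 𝓘(ℝ, E) 𝓘(ℝ, ℝ) ∞ f) (hf1 : ∀ x, -1 < f x)

theorem deformedMetric_inner (x : M) (v w : TangentSpace 𝓘(ℝ, E) x) :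
    (deformedMetric J g θ f hg hθ hunit hf hf1).inner x v w = g.inner x v w
      + f x * (θ x v * θ x w + J.onForm θ x v * J.onForm θ x w) := rfl

theorem deformedMetric_inner_eq_deformedForm (x : M) (v w : TangentSpace 𝓘(ℝ, E) x) :
    (deformedMetric J g θ f hg hθ hunit hf hf1).inner x v w =
      deformedForm J g θ f x v (J x w) :=
  (deformedForm_apply_J hg x v w).symm

theorem isHermitian_deformedMetric :
    IsHermitian J (deformedMetric J g θ f hg hθ hunit hf hf1) := by
  intro x v w
  simp only [deformedMetric_inner, hg x, onForm_apply, J.sq, map_neg]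
  ring

theorem fundamentalForm_deformedMetric :
    fundamentalForm J (deformedMetric J g θ f hg hθ hunit hf hf1) = deformedForm J g θ f := by
  funext x
  ext v w
  rw [fundamentalForm_apply, (isHermitian_deformedMetric hg hθ hunit hf hf1).inner_left,
    deformedMetric_inner_eq_deformedForm, J.sq, map_neg, neg_neg]

theorem deformedMetric_inner_sharp (x : M) (v : TangentSpace 𝓘(ℝ, E) x) :
    (deformedMetric J g θ f hg hθ hunit hf hf1).inner x (sharp g θ x) v = (1 + f x) * θ x v := by
  rw [deformedMetric_inner, inner_sharp, hunit, hg.onForm_sharp]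
  ring

theorem sharp_deformedMetric :
    sharp (deformedMetric J g θ f hg hθ hunit hf hf1) (fun x ↦ (1 + f x) • θ x) = sharp g θ :=
  funext fun x ↦ (sharp_eq_iff _ _).2 (deformedMetric_inner_sharp hg hθ hunit hf hf1 x)

theorem deformedMetric_inner_sharp_sharp (x : M) :
    (deformedMetric J g θ f hg hθ hunit hf hf1).inner x (sharp g θ x) (sharp g θ x) =
      1 + f x := by
  rw [deformedMetric_inner_sharp, hunit, mul_one]

theorem vnorm_deformedMetric_not_const (hconst : ¬ ∃ c : ℝ, ∀ x, f x = c) :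
    ¬ ∃ c : ℝ, ∀ x, vnorm (deformedMetric J g θ f hg hθ hunit hf hf1) (sharp g θ) x = c := by
  rintro ⟨c, hc⟩
  refine hconst ⟨c ^ 2 - 1, fun x ↦ ?_⟩
  rw [← hc x, vnorm, deformedMetric_inner_sharp_sharp, Real.sq_sqrt (by linarith [hf1 x])]
  ring

end

-- `dω̄ = θ ∧ ω + df ∧ θ ∧ Jθ - f θ ∧ d(Jθ)`, where the middle term vanishes and
-- `θ ∧ d(Jθ) = -θ ∧ ω = -θ ∧ ω̄`.
theorem IsVaismanWith.extDeriv2_deformedForm (h : IsVaismanWith J g θ)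
    (hunit : ∀ x, θ x (sharp g θ x) = 1) (hf : ContMDiff 𝓘(ℝ, E) 𝓘(ℝ, ℝ) ∞ f)
    (hw : ∀ x, wedge (diff f) θ x = 0) {x : M} {X Y Z : VField E M}
    (hX : DiffAt X x) (hY : DiffAt Y x) (hZ : DiffAt Z x) :
    extDeriv2 (deformedForm J g θ f) X Y Z x =
      wedge12 (fun x ↦ (1 + f x) • θ x) (deformedForm J g θ f) x (X x) (Y x) (Z x) := by
  have hθ := h.1.smooth
  have hJθ := hθ.onForm J
  have hwedge (u v) : diff f x u * θ x v - θ x u * diff f x v = 0 := by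
    rw [← wedge_apply, hw, zero_apply, zero_apply]
  have hexpand : extDeriv2 (deformedForm J g θ f) X Y Z x =
      wedge12 θ (fundamentalForm J g) x (X x) (Y x) (Z x)
      + wedge12 (diff f) (wedge θ (J.onForm θ)) x (X x) (Y x) (Z x)
      + f x * extDeriv2 (wedge θ (J.onForm θ)) X Y Z x := by
    rw [← h.1.lee x X Y Z hX hY hZ, add_assoc,
      ← extDeriv2_smul ((hf x).mdifferentiableAt (by simp)) (hθ.wedge hJθ) hX hY hZ,
      ← extDeriv2_add (smoothForm2_fundamentalForm J g) (.smul hf (hθ.wedge hJθ)) hX hY hZ]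
    rfl
  rw [hexpand, extDeriv2_wedge hθ hJθ hX hY hZ, h.extDeriv1_onForm (hunit x) hX hY,
    h.extDeriv1_onForm (hunit x) hX hZ, h.extDeriv1_onForm (hunit x) hY hZ,
    h.1.closed x X Y hX hY, h.1.closed x X Z hX hZ, h.1.closed x Y Z hY hZ]
  simp only [wedge12, deformedForm, add_apply, smul_apply, smul_eq_mul, wedge_apply]
  linear_combination J.onForm θ x (Z x) * hwedge (X x) (Y x)
    - J.onForm θ x (Y x) * hwedge (X x) (Z x) + J.onForm θ x (X x) * hwedge (Y x) (Z x)

theorem IsVaismanWith.isLCKWith_deformedMetric (h : IsVaismanWith J g θ)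
    (hunit : ∀ x, θ x (sharp g θ x) = 1) (hf : IsAdmissible θ f) :
    IsLCKWith J (deformedMetric J g θ f h.1.hermitian h.1.smooth hunit hf.smooth hf.gt_neg_one)
      (fun x ↦ (1 + f x) • θ x) where
  hermitian := isHermitian_deformedMetric _ _ _ _ _
  smooth := .smul (contMDiff_const.add hf.smooth) h.1.smooth
  closed := by
    refine .smul h.1.smooth h.1.closed (contMDiff_const.add hf.smooth) fun x ↦ ?_
    have hdiff := diff_const_add 1 ((hf.smooth x).mdifferentiableAt (by simp))
    rw [wedge, hdiff]
    exact hf.wedge_eq_zero x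
  lee x X Y Z hX hY hZ := by
    rw [fundamentalForm_deformedMetric]
    exact h.extDeriv2_deformedForm hunit hf.smooth hf.wedge_eq_zero hX hY hZ

theorem wedge_eq_zero_iff_exists_sharp_eq_smul {α : Form1 E M} {x : M}
    (hunit : θ x (sharp g θ x) = 1) :
    wedge α θ x = 0 ↔ ∃ c : ℝ, sharp g α x = c • sharp g θ x := by
  constructor
  · intro hwedge
    refine ⟨α x (sharp g θ x), (sharp_eq_iff g α).2 fun w ↦ ?_⟩
    have happly : wedge α θ x (sharp g θ x) w = 0 := by rw [hwedge, zero_apply, zero_apply]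
    rw [wedge_apply, hunit] at happly
    rw [map_smul, smul_apply, inner_sharp, smul_eq_mul]
    linarith
  · rintro ⟨c, hc⟩
    have hα : α x = c • θ x := by
      ext w
      rw [← inner_sharp g α x w, hc, map_smul, smul_apply, inner_sharp, smul_apply]
    ext v w
    simp only [wedge_apply, hα, smul_apply, smul_eq_mul, zero_apply]
    ring

end Deformation

section Constancy

variable {E : Type*} [NormedAddCommGroup E] [NormedSpace ℝ E]
  {M : Type*} [TopologicalSpace M] [ChartedSpace E M] [IsManifold 𝓘(ℝ, E) 1 M] {f : M → ℝ}

theorem hasFDerivAt_comp_chart_symm_zero (hf : MDifferentiable 𝓘(ℝ, E) 𝓘(ℝ, ℝ) f)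
    (hdiff : ∀ x, diff (E := E) f x = 0) (x₀ : M) {z : E} (hz : z ∈ (chartAt E x₀).target) :
    HasFDerivAt (f ∘ (chartAt E x₀).symm) (0 : E →L[ℝ] ℝ) z := by
  have hsymm : MDifferentiableAt 𝓘(ℝ, E) 𝓘(ℝ, E) (chartAt E x₀).symm z :=
    mdifferentiableAt_atlas_symm (chart_mem_atlas E x₀) hz
  have hf' := (hf ((chartAt E x₀).symm z)).hasMFDerivAt
  rw [show mfderiv 𝓘(ℝ, E) 𝓘(ℝ, ℝ) f ((chartAt E x₀).symm z) = 0 from hdiff _] at hf'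
  have hcomp := hf'.comp z hsymm.hasMFDerivAt
  rw [ContinuousLinearMap.zero_comp] at hcomp
  exact hcomp.hasFDerivAt

theorem isLocallyConstant_of_diff_eq_zero (hf : MDifferentiable 𝓘(ℝ, E) 𝓘(ℝ, ℝ) f)
    (hdiff : ∀ x, diff (E := E) f x = 0) : IsLocallyConstant f := by
  rw [IsLocallyConstant.iff_eventually_eq]
  intro x
  have hderiv (z) (hz : z ∈ (chartAt E x).target) :=
    hasFDerivAt_comp_chart_symm_zero hf hdiff x hz
  have hopen := (chartAt E x).open_target.isOpen_inter_preimage_of_fderiv_eq_zero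
    (fun z hz ↦ (hderiv z hz).differentiableAt.differentiableWithinAt)
    (fun z hz ↦ (hderiv z hz).fderiv) {f x}
  have hmem : chartAt E x x ∈ (chartAt E x).target ∩ (f ∘ (chartAt E x).symm) ⁻¹' {f x} :=
    ⟨mem_chart_target E x, congrArg f ((chartAt E x).left_inv (mem_chart_source E x))⟩
  filter_upwards [chart_source_mem_nhds E x,
    ((chartAt E x).continuousAt (mem_chart_source E x)) (hopen.mem_nhds hmem)] with y hy hfy
  exact (congrArg f ((chartAt E x).left_inv hy)).symm.trans hfy.2

end Constancy

section LeeForm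

variable {E : Type*} [NormedAddCommGroup E] [NormedSpace ℝ E] [FiniteDimensional ℝ E]
  {M : Type*} [TopologicalSpace M] [ChartedSpace E M] [IsManifold 𝓘(ℝ, E) ∞ M]
  {J : ComplexStructure E M} {g : RMetric E M} {θ θ' : Form1 E M} {f : M → ℝ} {x : M}

theorem exists_ne_zero_orthogonal (hdim : 3 ≤ Module.finrank ℝ E)
    (u : TangentSpace 𝓘(ℝ, E) x) :
    ∃ v : TangentSpace 𝓘(ℝ, E) x, v ≠ 0 ∧ g.inner x u v = 0 ∧ g.inner x (J x u) v = 0 := by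
  have : FiniteDimensional ℝ (TangentSpace 𝓘(ℝ, E) x) := inferInstanceAs (FiniteDimensional ℝ E)
  let L : TangentSpace 𝓘(ℝ, E) x →ₗ[ℝ] ℝ × ℝ :=
    (g.inner x u).toLinearMap.prod (g.inner x (J x u)).toLinearMap
  have hlt : Module.finrank ℝ (ℝ × ℝ) < Module.finrank ℝ (TangentSpace 𝓘(ℝ, E) x) := by
    rw [Module.finrank_prod, Module.finrank_self]
    exact hdim
  obtain ⟨v, hv, hv0⟩ := Submodule.exists_mem_ne_zero_of_ne_bot (L.ker_ne_bot_of_finrank_lt hlt)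
  exact ⟨v, hv0, congrArg Prod.fst hv, congrArg Prod.snd hv⟩

theorem IsHermitian.eq_zero_of_wedge12_eq_zero (hg : IsHermitian J g)
    (hdim : 3 ≤ Module.finrank ℝ E) {α : Form1 E M}
    (h : ∀ u v w, wedge12 α (fundamentalForm J g) x u v w = 0) : α x = 0 := by
  ext u
  obtain ⟨v, hv0, huv, hJuv⟩ := exists_ne_zero_orthogonal (J := J) (g := g) hdim u
  have hwedge := h u v (J x v)
  simp only [wedge12, fundamentalForm_apply, hg x, huv, hJuv, mul_zero, sub_zero, add_zero,
    mul_eq_zero, (g.pos x v hv0).ne', or_false] at hwedge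
  exact hwedge

theorem IsLCKWith.lee_unique (h : IsLCKWith J g θ) (h' : IsLCKWith J g θ')
    (hdim : 3 ≤ Module.finrank ℝ E) : θ = θ' := by
  funext x
  refine sub_eq_zero.1 (h.hermitian.eq_zero_of_wedge12_eq_zero hdim (α := θ - θ')
    fun u v w ↦ ?_)
  obtain ⟨X, hX, rfl⟩ := exists_diffAt_eq x u
  obtain ⟨Y, hY, rfl⟩ := exists_diffAt_eq x v
  obtain ⟨Z, hZ, rfl⟩ := exists_diffAt_eq x w
  have hlee := h.lee x X Y Z hX hY hZ
  rw [h'.lee x X Y Z hX hY hZ] at hlee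
  simp only [wedge12, Pi.sub_apply, sub_apply] at hlee ⊢
  linarith

theorem IsVaismanWith.not_isVaisman_deformedMetric [ConnectedSpace M] (h : IsVaismanWith J g θ)
    (hdim : 3 ≤ Module.finrank ℝ E) (hunit : ∀ x, θ x (sharp g θ x) = 1)
    (hf : IsAdmissible θ f) : ¬ IsVaisman J
      (deformedMetric J g θ f h.1.hermitian h.1.smooth hunit hf.smooth hf.gt_neg_one) := by
  rintro ⟨θ', hlck', hparallel⟩
  have hlck := h.isLCKWith_deformedMetric hunit hf
  obtain rfl := hlck.lee_unique hlck' hdim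
  have hdiff := hparallel.diff_apply_sharp hlck.smooth
  simp only [sharp_deformedMetric, smul_apply, hunit, smul_eq_mul, mul_one] at hdiff
  have hfdiff := hf.smooth.mdifferentiable (by simp)
  simp only [diff_const_add 1 (hfdiff _)] at hdiff
  have hconst := isLocallyConstant_of_diff_eq_zero hfdiff hdiff
  exact hf.nonconst ⟨f (Classical.arbitrary M),
    fun x ↦ hconst.apply_eq_of_preconnectedSpace x _⟩

theorem IsVaismanWith.exists_deformation (h : IsVaismanWith J g θ)
    (hdim : 3 ≤ Module.finrank ℝ E) (hθ : ∀ x, fnorm g θ x = 1) (hf : IsAdmissible θ f) :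
    ∃ gbar : RMetric E M,
      (∀ (x : M) (v w : TangentSpace 𝓘(ℝ, E) x),
        gbar.inner x v w = deformedForm J g θ f x v (J x w)) ∧
      fundamentalForm J gbar = deformedForm J g θ f ∧
      IsLCKWith J gbar (fun x ↦ (1 + f x) • θ x) ∧
      sharp gbar (fun x ↦ (1 + f x) • θ x) = sharp g θ ∧
      IsHolomorphic J (sharp g θ) ∧
      (∀ x, gbar.inner x (sharp g θ x) (sharp g θ x) = 1 + f x) ∧
      (¬ ∃ c : ℝ, ∀ x, vnorm gbar (sharp g θ) x = c) ∧
      (ConnectedSpace M → ¬ IsVaisman J gbar) :=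
  have hunit x := fnorm_eq_one_iff.1 (hθ x)
  ⟨deformedMetric J g θ f h.1.hermitian h.1.smooth hunit hf.smooth hf.gt_neg_one,
    deformedMetric_inner_eq_deformedForm _ _ _ _ _, fundamentalForm_deformedMetric ..,
    h.isLCKWith_deformedMetric hunit hf, sharp_deformedMetric .., h.isHolomorphic_sharp,
    deformedMetric_inner_sharp_sharp _ _ _ _ _,
    vnorm_deformedMetric_not_const _ _ _ _ _ hf.nonconst,
    fun _ ↦ h.not_isVaisman_deformedMetric hdim hunit hf⟩

end LeeForm

/-! ### Derivatives of tensor fields in the preferred charts -/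

section ChartCalculus

variable {E : Type*} [NormedAddCommGroup E] [NormedSpace ℝ E]
  {M : Type*} [TopologicalSpace M] [ChartedSpace E M]

theorem diff_eq_fderiv {x : M} {f : M → ℝ} (hf : MDifferentiableAt 𝓘(ℝ, E) 𝓘(ℝ, ℝ) f x) :
    diff (E := E) f x = fderiv ℝ (f ∘ (chartAt E x).symm) (chartAt E x x) := by
  rw [diff, hf.mvfderiv]
  simp only [mfld_simps, fderivWithin_univ]
  rfl

variable [IsManifold 𝓘(ℝ, E) ∞ M] {x : M} {X Y : VField E M}

theorem differentiableAt_comp_chart_symm {F : Type*} [NormedAddCommGroup F] [NormedSpace ℝ F]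
    {f : M → F} (hf : MDifferentiableAt 𝓘(ℝ, E) 𝓘(ℝ, F) f x) :
    DifferentiableAt ℝ (f ∘ (chartAt E x).symm) (chartAt E x x) := by
  rw [← (chartAt E x).left_inv (mem_chart_source E x)] at hf
  exact (hf.comp _ (mdifferentiableAt_atlas_symm (chart_mem_atlas E x)
    (mem_chart_target E x))).differentiableAt

/-- The vector field `X` read in the chart at `x`, as a map defined on the model space. -/
def inChart (x : M) (X : VField E M) (z : E) : E :=
  coframe x ((chartAt E x).symm z) (X ((chartAt E x).symm z))

theorem frame_inChart {z : E} (hz : z ∈ (chartAt E x).target) (X : VField E M) :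
    frame x ((chartAt E x).symm z) (inChart x X z) = X ((chartAt E x).symm z) :=
  frame_coframe ((chartAt E x).map_target hz) _

theorem inChart_self (x : M) (X : VField E M) : inChart x X (chartAt E x x) = X x := by
  rw [inChart, (chartAt E x).left_inv (mem_chart_source E x), coframe,
    TangentBundle.continuousLinearMapAt_trivializationAt (mem_chart_source E x),
    mfderiv_extChartAt_self]
  rfl

theorem DiffAt.differentiableAt_inChart (hX : DiffAt X x) :
    DifferentiableAt ℝ (inChart x X) (chartAt E x x) := by
  have hcoord := (mdifferentiableAt_section (F := E) (E := TangentSpace 𝓘(ℝ, E)) 𝓘(ℝ, E) X).1 hX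
  refine differentiableAt_comp_chart_symm (f := fun y ↦ coframe x y (X y))
    (hcoord.congr_of_eventuallyEq ?_)
  filter_upwards [chart_source_mem_nhds E x] with y hy
  rw [Trivialization.continuousLinearMapAt_apply, Trivialization.coe_linearMapAt_of_mem _ hy]

/-- The derivative at `x` of the vector field `X` read in the chart at `x`: the covariant
derivative at `x` for the flat connection of that chart. -/
def chartDeriv (X : VField E M) (x : M) : TangentSpace 𝓘(ℝ, E) x →L[ℝ] TangentSpace 𝓘(ℝ, E) x :=
  (fderiv ℝ (inChart x X) (chartAt E x x) : E →L[ℝ] E)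

theorem chartDeriv_add (hX : DiffAt X x) (hY : DiffAt Y x) :
    chartDeriv (X + Y) x = chartDeriv X x + chartDeriv Y x := by
  have hadd : inChart x (X + Y) = inChart x X + inChart x Y :=
    funext fun z ↦ map_add (coframe x _) _ _
  rw [chartDeriv, hadd]
  exact fderiv_add hX.differentiableAt_inChart hY.differentiableAt_inChart

theorem chartDeriv_smul {f : M → ℝ} (hf : MDifferentiableAt 𝓘(ℝ, E) 𝓘(ℝ, ℝ) f x)
    (hX : DiffAt X x) :
    chartDeriv (f • X) x = f x • chartDeriv X x + (diff f x).smulRight (X x) := by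
  have hsmul : inChart x (f • X) = (f ∘ (chartAt E x).symm) • inChart x X :=
    funext fun z ↦ map_smul (coframe x _) _ _
  have hderiv := fderiv_smul (differentiableAt_comp_chart_symm hf) hX.differentiableAt_inChart
  rw [Function.comp_apply, (chartAt E x).left_inv (mem_chart_source E x), inChart_self,
    ← diff_eq_fderiv hf] at hderiv
  rw [chartDeriv, hsmul]
  exact hderiv

/-- The connection that differs from the flat connection of the chart at `x` by `Γ x`, for every
`x`: `∇_v Y = D_v Y + Γ(Y, v)`. -/
def chartConnection (Γ : ∀ x : M, TangentSpace 𝓘(ℝ, E) x →L[ℝ]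
      TangentSpace 𝓘(ℝ, E) x →L[ℝ] TangentSpace 𝓘(ℝ, E) x) :
    CovariantDerivative 𝓘(ℝ, E) E (fun x : M ↦ TangentSpace 𝓘(ℝ, E) x) where
  toFun Y x := chartDeriv Y x + Γ x (Y x)
  isCovariantDerivativeOnUniv :=
    { add := fun hX hY _ ↦ by
        rw [chartDeriv_add hX hY, Pi.add_apply, map_add]
        abel
      leibniz := fun hX hf _ ↦ by
        rw [chartDeriv_smul hf hX, Pi.smul_apply', map_smul, smul_add]
        exact add_right_comm _ _ _ }

theorem chartConnection_apply (Γ : ∀ x : M, TangentSpace 𝓘(ℝ, E) x →L[ℝ]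
      TangentSpace 𝓘(ℝ, E) x →L[ℝ] TangentSpace 𝓘(ℝ, E) x) (Y : VField E M) (x : M) :
    chartConnection Γ Y x = chartDeriv Y x + Γ x (Y x) := rfl

theorem mpullbackWithin_chart_symm_eventuallyEq (x : M) (X : VField E M) :
    VectorField.mpullbackWithin 𝓘(ℝ, E) 𝓘(ℝ, E) (extChartAt 𝓘(ℝ, E) x).symm X
      (Set.range 𝓘(ℝ, E)) =ᶠ[𝓝 (chartAt E x x)] inChart x X := by
  filter_upwards [chart_target_mem_nhds E x] with z hz
  have hsource : (chartAt E x).symm z ∈ (chartAt E x).source := (chartAt E x).map_target hz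
  have hframe := TangentBundle.symmL_trivializationAt (I := 𝓘(ℝ, E)) hsource
  have hcoframe : coframe x ((chartAt E x).symm z) = (frame x ((chartAt E x).symm z)).inverse :=
    (ContinuousLinearMap.inverse_eq (ContinuousLinearMap.ext (frame_coframe hsource))
      (ContinuousLinearMap.ext (coframe_frame hsource))).symm
  rw [show extChartAt 𝓘(ℝ, E) x ((chartAt E x).symm z) = z from (chartAt E x).right_inv hz]
    at hframe
  rw [VectorField.mpullbackWithin_apply, ← hframe, inChart, hcoframe]
  rfl

theorem bracket_eq (X Y : VField E M) (x : M) :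
    bracket X Y x = chartDeriv Y x (X x) - chartDeriv X x (Y x) := by
  have hbracket := VectorField.mlieBracketWithin_apply (I := 𝓘(ℝ, E)) (V := X) (W := Y)
    (s := Set.univ) (x₀ := x)
  have hset : (extChartAt 𝓘(ℝ, E) x).symm ⁻¹' Set.univ ∩ Set.range 𝓘(ℝ, E) = Set.univ := by simp
  rw [mfderiv_extChartAt_self, hset] at hbracket
  refine hbracket.trans ((DFunLike.congr_fun
    (ContinuousLinearMap.inverse_id (R := ℝ) (M := E)) _).trans ?_)
  refine (congrFun (VectorField.lieBracketWithin_univ (𝕜 := ℝ) (E := E)) _).trans ?_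
  refine ((mpullbackWithin_chart_symm_eventuallyEq x X).lieBracket_vectorField_eq
    (mpullbackWithin_chart_symm_eventuallyEq x Y)).trans ?_
  rw [VectorField.lieBracket, inChart_self, inChart_self]
  rfl

theorem smoothForm1_of_comp_frame_eq {α : Form1 E M} {b : E → E →L[ℝ] ℝ}
    (hb : ∀ x : M, ContDiffAt ℝ ∞ b (chartAt E x x))
    (hα : ∀ x, ∀ y ∈ (chartAt E x).source, (α y).comp (frame x y) = b (chartAt E x y)) :
    SmoothForm1 α := by
  refine smoothForm1_iff.2 fun x ↦ ?_
  refine ((hb x).contMDiffAt.comp x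
    (contMDiffAt_extChartAt (I := 𝓘(ℝ, E)))).congr_of_eventuallyEq ?_
  filter_upwards [chart_source_mem_nhds E x] with y hy
  exact hα x y hy

theorem smoothForm2_of_coordForm2_eq {B : Form2 E M} {b : E → E →L[ℝ] E →L[ℝ] ℝ}
    (hb : ∀ x : M, ContDiffAt ℝ ∞ b (chartAt E x x))
    (hB : ∀ x, ∀ y ∈ (chartAt E x).source, coordForm2 B x y = b (chartAt E x y)) :
    SmoothForm2 B := by
  refine smoothForm2_iff.2 fun x ↦ ?_
  refine ((hb x).contMDiffAt.comp x
    (contMDiffAt_extChartAt (I := 𝓘(ℝ, E)))).congr_of_eventuallyEq ?_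
  filter_upwards [chart_source_mem_nhds E x] with y hy
  exact hB x y hy

theorem SmoothForm1.diff_apply_eq_fderiv {α : Form1 E M} (hα : SmoothForm1 α)
    {b : E → E →L[ℝ] ℝ}
    (hb : ∀ y ∈ (chartAt E x).source, (α y).comp (frame x y) = b (chartAt E x y))
    (hY : DiffAt Y x) :
    diff (E := E) (fun y ↦ α y (Y y)) x =
      fderiv ℝ (fun z ↦ b z (inChart x Y z)) (chartAt E x x) := by
  rw [diff_eq_fderiv (hα.mdifferentiableAt_apply hY)]
  refine Filter.EventuallyEq.fderiv_eq ?_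
  filter_upwards [chart_target_mem_nhds E x] with z hz
  have hz' := DFunLike.congr_fun (hb _ ((chartAt E x).map_target hz)) (inChart x Y z)
  rwa [ContinuousLinearMap.comp_apply, frame_inChart hz, (chartAt E x).right_inv hz] at hz'

theorem SmoothForm2.diff_apply_eq_fderiv {B : Form2 E M} (hB : SmoothForm2 B)
    {b : E → E →L[ℝ] E →L[ℝ] ℝ}
    (hb : ∀ y ∈ (chartAt E x).source, coordForm2 B x y = b (chartAt E x y))
    (hX : DiffAt X x) (hY : DiffAt Y x) :
    diff (E := E) (fun y ↦ B y (X y) (Y y)) x =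
      fderiv ℝ (fun z ↦ b z (inChart x X z) (inChart x Y z)) (chartAt E x x) := by
  rw [diff_eq_fderiv (hB.mdifferentiableAt_apply hX hY)]
  refine Filter.EventuallyEq.fderiv_eq ?_
  filter_upwards [chart_target_mem_nhds E x] with z hz
  rw [← (chartAt E x).right_inv hz, ← hb _ ((chartAt E x).map_target hz), coordForm2_apply,
    (chartAt E x).right_inv hz, frame_inChart hz, frame_inChart hz]
  rfl

end ChartCalculus

/-! ### Weyl structures given by the flat connections of the charts -/

section ChartParallel

variable {E : Type*} [NormedAddCommGroup E] [NormedSpace ℝ E]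
  {M : Type*} [TopologicalSpace M] [ChartedSpace E M] [IsManifold 𝓘(ℝ, E) ∞ M]

/-- The endomorphism field `A` is parallel for the flat connection of each preferred chart, at the
centre of that chart. -/
def IsChartParallel (A : EndField E M) : Prop :=
  ∀ (x : M) (X : VField E M), DiffAt X x → ∀ v,
    chartDeriv (fun y ↦ A y (X y)) x v = A x (chartDeriv X x v)

/-- The flat connection of each preferred chart satisfies `D g = θ ⊗ g` at the centre of that
chart, that is, it is a Weyl connection of `g` with Lee form `θ`. -/
def IsChartWeyl (g : RMetric E M) (θ : Form1 E M) : Prop :=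
  ∀ (x : M) (X Y : VField E M), DiffAt X x → DiffAt Y x → ∀ v,
    diff (fun y ↦ g.inner y (X y) (Y y)) x v =
      g.inner x (chartDeriv X x v) (Y x) + g.inner x (X x) (chartDeriv Y x v)
        + θ x v * g.inner x (X x) (Y x)

variable {x : M} {X Y Z : VField E M}

theorem IsChartParallel.nijenhuis_eq_zero {A : EndField E M} (hA : IsChartParallel A)
    (hsq : ∀ x v, A x (A x v) = -v) (hX : DiffAt X x) (hY : DiffAt Y x) :
    bracket (fun y ↦ A y (X y)) (fun y ↦ A y (Y y)) x - A x (bracket (fun y ↦ A y (X y)) Y x)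
      - A x (bracket X (fun y ↦ A y (Y y)) x) - bracket X Y x = 0 := by
  simp only [bracket_eq, hA x X hX, hA x Y hY, map_sub, hsq]
  abel

variable {J : ComplexStructure E M} {g : RMetric E M} {θ : Form1 E M}

theorem IsChartWeyl.diff_fundamentalForm (hg : IsChartWeyl g θ) (hJ : IsChartParallel J.toFun)
    (hX : DiffAt X x) (hY : DiffAt Y x) (v : TangentSpace 𝓘(ℝ, E) x) :
    diff (fun y ↦ fundamentalForm J g y (X y) (Y y)) x v =
      fundamentalForm J g x (chartDeriv X x v) (Y x)
        + fundamentalForm J g x (X x) (chartDeriv Y x v)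
        + θ x v * fundamentalForm J g x (X x) (Y x) := by
  simp only [fundamentalForm_apply, hg x _ _ (J.diffAt hX) hY, hJ x X hX]

theorem IsChartWeyl.extDeriv2_fundamentalForm (hg : IsChartWeyl g θ)
    (hJ : IsChartParallel J.toFun) (hJg : IsHermitian J g)
    (hX : DiffAt X x) (hY : DiffAt Y x) (hZ : DiffAt Z x) :
    extDeriv2 (fundamentalForm J g) X Y Z x =
      wedge12 θ (fundamentalForm J g) x (X x) (Y x) (Z x) := by
  simp only [extDeriv2, wedge12, bracket_eq, hg.diff_fundamentalForm hJ hX hY,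
    hg.diff_fundamentalForm hJ hX hZ, hg.diff_fundamentalForm hJ hY hZ, map_sub, sub_apply,
    hJg.fundamentalForm_swap x (chartDeriv _ _ _)]
  ring

/-- The covariant derivative of `θ` for the flat connection of each preferred chart, at the centre
of that chart, is `θ ⊗ θ - ½ g`. If that connection is a Weyl connection of `g` with Lee form `θ`
and `θ` has norm `1`, this says that `θ` is parallel for the Levi-Civita connection of `g`. -/
def HasCylindricalLeeForm (g : RMetric E M) (θ : Form1 E M) : Prop :=
  ∀ (x : M) (Y : VField E M), DiffAt Y x → ∀ v,
    diff (fun y ↦ θ y (Y y)) x v =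
      θ x (chartDeriv Y x v) + (θ x v * θ x (Y x) - 1 / 2 * g.inner x v (Y x))

theorem HasCylindricalLeeForm.closed1 (hθ : HasCylindricalLeeForm g θ) : Closed1 θ := by
  intro x X Y hX hY
  rw [extDeriv1, hθ x X hX, hθ x Y hY, bracket_eq, map_sub, g.symm]
  ring

variable [FiniteDimensional ℝ E]

variable (g θ) in
/-- The difference between the Levi-Civita connection of `g` and a torsion-free connection with
`D g = θ ⊗ g`: `weylDifference g θ x w v = ½ (θ(w) v + θ(v) w - g(w, v) θ♯)`. -/
def weylDifference (x : M) : TangentSpace 𝓘(ℝ, E) x →L[ℝ]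
    TangentSpace 𝓘(ℝ, E) x →L[ℝ] TangentSpace 𝓘(ℝ, E) x :=
  let α : E →L[ℝ] ℝ := θ x
  let T : E := sharp g θ x
  let B : E →L[ℝ] E →L[ℝ] ℝ := g.inner x
  (1 / 2 : ℝ) • (α.smulRight (ContinuousLinearMap.id ℝ E)
    + ContinuousLinearMap.smulRightL ℝ E E α
    - ((ContinuousLinearMap.smulRightL ℝ E E).flip T).comp B)

theorem weylDifference_apply (x : M) (w v : TangentSpace 𝓘(ℝ, E) x) :
    weylDifference g θ x w v =
      (1 / 2 : ℝ) • (θ x w • v + θ x v • w - g.inner x w v • sharp g θ x) := rfl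

theorem weylDifference_comm (x : M) (w v : TangentSpace 𝓘(ℝ, E) x) :
    weylDifference g θ x w v = weylDifference g θ x v w := by
  rw [weylDifference_apply, weylDifference_apply, g.symm x w v, add_comm (θ x w • v)]

theorem inner_weylDifference_add (x : M) (w u v : TangentSpace 𝓘(ℝ, E) x) :
    g.inner x (weylDifference g θ x w v) u + g.inner x w (weylDifference g θ x u v) =
      θ x v * g.inner x w u := by
  simp only [weylDifference_apply, map_smul, map_sub, map_add, smul_apply, sub_apply, add_apply,
    smul_eq_mul, inner_sharp, g.symm x w (sharp g θ x), g.symm x v u]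
  ring

theorem apply_weylDifference (hunit : θ x (sharp g θ x) = 1) (w v : TangentSpace 𝓘(ℝ, E) x) :
    θ x (weylDifference g θ x w v) = θ x v * θ x w - 1 / 2 * g.inner x v w := by
  simp only [weylDifference_apply, map_smul, map_sub, map_add, smul_eq_mul, hunit, g.symm x w v]
  ring

theorem IsChartWeyl.isLeviCivita (hg : IsChartWeyl g θ) :
    IsLeviCivita g (chartConnection (weylDifference g θ)) where
  torsion_free x X Y _ _ := by
    simp only [chartConnection_apply, bracket_eq, add_apply, weylDifference_comm x (X x)]
    abel
  metric x v Y Z hY hZ := by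
    simp only [chartConnection_apply, hg x Y Z hY hZ, add_apply, map_add]
    linarith [inner_weylDifference_add (g := g) (θ := θ) x (Y x) (Z x) v]

theorem isVaismanWith_of_isChartWeyl (hg : IsChartWeyl g θ) (hJ : IsChartParallel J.toFun)
    (hJg : IsHermitian J g) (hsmooth : SmoothForm1 θ) (hθ : HasCylindricalLeeForm g θ)
    (hunit : ∀ x, θ x (sharp g θ x) = 1) : IsVaismanWith J g θ := by
  refine ⟨⟨hJg, hsmooth, hθ.closed1,
    fun _ _ _ _ hX hY hZ ↦ hg.extDeriv2_fundamentalForm hJ hJg hX hY hZ⟩,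
    chartConnection (weylDifference g θ), hg.isLeviCivita, fun x v Y hY ↦ ?_⟩
  rw [hθ x Y hY, chartConnection_apply, add_apply, map_add, apply_weylDifference (hunit x),
    sub_self]

end ChartParallel

/-! ### The cylindrical metric on a punctured inner product space -/

section CylindricalMetric

variable {F : Type*} [NormedAddCommGroup F] [InnerProductSpace ℝ F] {z : F}

/-- The metric `4 r⁻² ⟨·, ·⟩`; on the complement of the origin it is a product metric on
`(0, ∞) × S`. -/
def cylMetric (z : F) : F →L[ℝ] F →L[ℝ] ℝ := (4 / ‖z‖ ^ 2) • innerSL ℝ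

/-- The form `-2 dr / r`, written as the metric dual of the vector field `-z / 2`. -/
def cylLee (z : F) : F →L[ℝ] ℝ := cylMetric z (-(1 / 2 : ℝ) • z)

theorem cylMetric_apply (z v w : F) : cylMetric z v w = 4 / ‖z‖ ^ 2 * inner ℝ v w := rfl

theorem cylLee_apply (z v : F) : cylLee z v = -2 * (inner ℝ z v / ‖z‖ ^ 2) := by
  rw [cylLee, cylMetric_apply, real_inner_smul_left]
  ring

theorem cylMetric_comm (z v w : F) : cylMetric z v w = cylMetric z w v := by
  rw [cylMetric_apply, cylMetric_apply, real_inner_comm]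

theorem cylMetric_self_pos (hz : z ≠ 0) {v : F} (hv : v ≠ 0) : 0 < cylMetric z v v := by
  have hinner : 0 < inner ℝ v v := real_inner_self_pos.2 hv
  rw [cylMetric_apply]
  positivity

theorem cylMetric_smul {c : ℝ} (hc : c ≠ 0) (z v w : F) :
    cylMetric (c • z) (c • v) (c • w) = cylMetric z v w := by
  rw [cylMetric_apply, cylMetric_apply, norm_smul, Real.norm_eq_abs, mul_pow, sq_abs,
    real_inner_smul_left, real_inner_smul_right]
  field_simp

theorem cylLee_smul {c : ℝ} (hc : c ≠ 0) (z v : F) : cylLee (c • z) (c • v) = cylLee z v := by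
  rw [cylLee, cylLee, smul_comm, cylMetric_smul hc]

theorem cylLee_apply_self (hz : z ≠ 0) : cylLee z (-(1 / 2 : ℝ) • z) = 1 := by
  have hnorm : ‖z‖ ≠ 0 := norm_ne_zero_iff.2 hz
  rw [cylLee_apply, real_inner_smul_right, real_inner_self_eq_norm_sq]
  field_simp

theorem contDiffAt_cylMetric (hz : z ≠ 0) : ContDiffAt ℝ ∞ (cylMetric (F := F)) z := by
  have hfactor : ContDiffAt ℝ ∞ (fun z : F ↦ 4 / ‖z‖ ^ 2) z :=
    contDiffAt_const.div (contDiff_norm_sq ℝ).contDiffAt (pow_ne_zero 2 (norm_ne_zero_iff.2 hz))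
  -- `IsBoundedSMul ℝ (F →L[ℝ] F →L[ℝ] ℝ)` is not found directly, hence the abstract space `G`.
  have hsmul {G : Type _} [NormedAddCommGroup G] [NormedSpace ℝ G] (B : G) :
      ContDiffAt ℝ ∞ (fun z : F ↦ (4 / ‖z‖ ^ 2) • B) z := hfactor.smul_const B
  exact hsmul _

theorem contDiffAt_cylLee (hz : z ≠ 0) : ContDiffAt ℝ ∞ (cylLee (F := F)) z :=
  (contDiffAt_cylMetric hz).clm_apply (contDiffAt_id.const_smul _)

theorem hasFDerivAt_cylFactor (hz : z ≠ 0) :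
    HasFDerivAt (fun z : F ↦ 4 / ‖z‖ ^ 2) ((4 / ‖z‖ ^ 2) • cylLee z) z := by
  have hnorm : ‖z‖ ^ 2 ≠ 0 := pow_ne_zero 2 (norm_ne_zero_iff.2 hz)
  refine (((hasDerivAt_inv hnorm).comp_hasFDerivAt z
    (hasStrictFDerivAt_norm_sq z).hasFDerivAt).const_mul 4).congr_fderiv ?_
  ext v
  simp only [smul_apply, smul_eq_mul, innerSL_apply_apply, nsmul_eq_mul, cylLee_apply]
  push_cast
  ring

theorem fderiv_cylMetric_apply (hz : z ≠ 0) {V W : F → F} (hV : DifferentiableAt ℝ V z)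
    (hW : DifferentiableAt ℝ W z) (v : F) :
    fderiv ℝ (fun z ↦ cylMetric z (V z) (W z)) z v =
      cylMetric z (fderiv ℝ V z v) (W z) + cylMetric z (V z) (fderiv ℝ W z v)
        + cylLee z v * cylMetric z (V z) (W z) := by
  have hderiv := ((hasFDerivAt_cylFactor hz).mul (hV.hasFDerivAt.inner ℝ hW.hasFDerivAt)).fderiv
  refine (DFunLike.congr_fun hderiv v).trans ?_
  simp only [add_apply, smul_apply, smul_eq_mul, ContinuousLinearMap.comp_apply,
    ContinuousLinearMap.prod_apply, fderivInnerCLM_apply, cylMetric_apply]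
  ring

theorem fderiv_cylLee_apply (hz : z ≠ 0) {V : F → F} (hV : DifferentiableAt ℝ V z) (v : F) :
    fderiv ℝ (fun z ↦ cylLee z (V z)) z v =
      cylLee z (fderiv ℝ V z v) + (cylLee z v * cylLee z (V z) - 1 / 2 * cylMetric z v (V z)) := by
  have hradial : HasFDerivAt (fun z : F ↦ -(1 / 2 : ℝ) • z)
      (-(1 / 2 : ℝ) • ContinuousLinearMap.id ℝ F) z := (hasFDerivAt_id z).const_smul _
  refine (fderiv_cylMetric_apply hz hradial.differentiableAt hV v).trans ?_
  rw [hradial.fderiv, smul_apply, ContinuousLinearMap.id_apply, map_smul, smul_apply, smul_eq_mul]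
  change _ + cylLee z _ + cylLee z v * cylLee z _ = _
  ring

theorem hasFDerivAt_norm_of_ne_zero (hz : z ≠ 0) :
    HasFDerivAt (fun z : F ↦ ‖z‖) (-(‖z‖ / 2) • cylLee z) z := by
  have hnorm : 0 < ‖z‖ := norm_pos_iff.2 hz
  have hsqrt := (hasStrictFDerivAt_norm_sq z).hasFDerivAt.sqrt (pow_pos hnorm 2).ne'
  simp only [Real.sqrt_sq (norm_nonneg _)] at hsqrt
  refine hsqrt.congr_fderiv ?_
  ext v
  simp only [smul_apply, smul_eq_mul, innerSL_apply_apply, nsmul_eq_mul, cylLee_apply]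
  push_cast
  field_simp

end CylindricalMetric

section MulI

variable {n : ℕ}

variable (n) in
/-- Multiplication by `i` on `ℂⁿ`, as a real linear map. -/
def mulI : Cn n →L[ℝ] Cn n :=
  (Complex.I • ContinuousLinearMap.id ℂ (Cn n)).restrictScalars ℝ

theorem mulI_apply (v : Cn n) : mulI n v = Complex.I • v := rfl

theorem mulI_mulI (v : Cn n) : mulI n (mulI n v) = -v := by
  rw [mulI_apply, mulI_apply, smul_smul, Complex.I_mul_I, neg_one_smul]

theorem inner_mulI_mulI (v w : Cn n) : inner ℝ (mulI n v) (mulI n w) = inner ℝ v w := by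
  have hnorm (u : Cn n) : ‖mulI n u‖ = ‖u‖ := by
    rw [mulI_apply, norm_smul, Complex.norm_I, one_mul]
  exact (LinearMap.norm_map_iff_inner_map_map (mulI n)).1 hnorm v w

theorem cylMetric_mulI_mulI (z v w : Cn n) :
    cylMetric z (mulI n v) (mulI n w) = cylMetric z v w := by
  rw [cylMetric_apply, inner_mulI_mulI, cylMetric_apply]

end MulI

/-! ### Charts of the Hopf manifold -/

theorem eventually_nhds_coe_iff {X : Type*} [TopologicalSpace X] {U : TopologicalSpace.Opens X}
    {x : U} {P : X → Prop} : (∀ᶠ z in 𝓝 (x : X), P z) ↔ ∀ᶠ y : U in 𝓝 x, P y := by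
  rw [← U.isOpen.isOpenEmbedding_subtypeVal.map_nhds_eq x, Filter.eventually_map]
  rfl

section HopfCharts

variable {n : ℕ} {a : ℝ} [ha : Fact (1 < a)] {p q q' : Hopf n a} {z : Cn n}

theorem hopfProj_surjective : Function.Surjective (hopfProj a : punctured n → Hopf n a) :=
  Quotient.mk_surjective

theorem continuous_hopfProj : Continuous (hopfProj a : punctured n → Hopf n a) :=
  continuous_quotient_mk'

theorem hopfProj_smul (k : Dilations a) (x : punctured n) :
    hopfProj a (k • x) = hopfProj a x := hopfProj_eq_iff.2 ⟨k, rfl⟩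

/-- The map on the Hopf manifold induced by a map on `ℂⁿ \ {0}` that is invariant under the
dilations. -/
def hopfLift {α : Type*} (φ : punctured n → α) (hφ : ∀ (k : Dilations a) x, φ (k • x) = φ x) :
    Hopf n a → α :=
  Quotient.lift φ (by rintro _ y ⟨k, rfl⟩; exact hφ k y)

theorem exists_chart_lift (q : Hopf n a) :
    ∃ s : OpenPartialHomeomorph (Hopf n a) (punctured n),
      s.source = (chartAt (Cn n) q).source ∧ (∀ z, s.symm z = hopfProj a z) ∧
      ∀ p, chartAt (Cn n) q p = (s p : Cn n) := by
  obtain ⟨p, hp⟩ := chart_mem_atlas (Cn n) q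
  rw [← hp]
  refine ⟨hopf_isLocalHomeomorph.localInverseAt _, ?_, fun z ↦ ?_, fun _ ↦ rfl⟩
  · ext z
    simp only [TopologicalSpace.Opens.chartAt_eq, OpenPartialHomeomorph.trans_source,
      OpenPartialHomeomorph.subtypeRestr_source, chartAt_self_eq,
      OpenPartialHomeomorph.refl_source, Set.preimage_univ, Set.inter_univ]
    rfl
  · rw [IsLocalHomeomorph.localInverseAt_symm]

theorem chart_target_ne_zero (hz : z ∈ (chartAt (Cn n) q).target) : z ≠ 0 := by
  obtain ⟨s, -, -, hs⟩ := exists_chart_lift q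
  rw [← (chartAt (Cn n) q).right_inv hz, hs]
  exact punctured_ne_zero _

theorem chart_symm_eq (hz : z ∈ (chartAt (Cn n) q).target) :
    (chartAt (Cn n) q).symm z = hopfProj a ⟨z, chart_target_ne_zero hz⟩ := by
  obtain ⟨s, hsource, hsymm, hs⟩ := exists_chart_lift q
  have hlift : s ((chartAt (Cn n) q).symm z) = ⟨z, chart_target_ne_zero hz⟩ :=
    Subtype.ext ((hs _).symm.trans ((chartAt (Cn n) q).right_inv hz))
  rw [← hlift, ← hsymm, s.left_inv (hsource ▸ (chartAt (Cn n) q).map_target hz)]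

theorem hopfProj_chart (hp : p ∈ (chartAt (Cn n) q).source) :
    hopfProj a ⟨chartAt (Cn n) q p, chart_target_ne_zero ((chartAt (Cn n) q).map_source hp)⟩ =
      p := by
  rw [← chart_symm_eq ((chartAt (Cn n) q).map_source hp), (chartAt (Cn n) q).left_inv hp]

theorem exists_chart_hopfProj_eq {x : punctured n}
    (hx : hopfProj a x ∈ (chartAt (Cn n) q).source) :
    ∃ c : ℝ, 0 < c ∧ ∀ᶠ y in 𝓝 x, hopfProj a y ∈ (chartAt (Cn n) q).source ∧
      chartAt (Cn n) q (hopfProj a y) = c • (y : Cn n) := by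
  obtain ⟨s, hsource, hsymm, hs⟩ := exists_chart_lift q
  rw [← hsource] at hx ⊢
  obtain ⟨k, hk⟩ : ∃ k : Dilations a, k • x = s (hopfProj a x) :=
    hopfProj_eq_iff.1 (by rw [← hsymm, s.left_inv hx])
  refine ⟨a ^ k.exponent, dilation_pos _, ?_⟩
  have hnear : ∀ᶠ y in 𝓝 x, k • y ∈ s.target :=
    (continuous_const_smul k).continuousAt.eventually_mem
      (s.open_target.mem_nhds (hk ▸ s.map_source hx))
  filter_upwards [hnear] with y hy
  have hproj : s.symm (k • y) = hopfProj a y := by rw [hsymm, hopfProj_smul]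
  rw [← hproj, hs, s.right_inv hy, coe_dilation_smul]
  exact ⟨s.map_target hy, rfl⟩

theorem exists_chart_chart_symm_eq (hp : p ∈ (chartAt (Cn n) q).source)
    (hp' : p ∈ (chartAt (Cn n) q').source) :
    ∃ c : ℝ, 0 < c ∧ ∀ᶠ z in 𝓝 (chartAt (Cn n) q p),
      chartAt (Cn n) q' ((chartAt (Cn n) q).symm z) = c • z := by
  have htarget := (chartAt (Cn n) q).map_source hp
  rw [← hopfProj_chart hp] at hp'
  obtain ⟨c, hc, hnear⟩ := exists_chart_hopfProj_eq hp'
  refine ⟨c, hc, (eventually_nhds_coe_iff (U := punctured n)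
    (x := ⟨_, chart_target_ne_zero htarget⟩)).2 ?_⟩
  filter_upwards [hnear, eventually_nhds_coe_iff.1
    ((chartAt (Cn n) q).open_target.mem_nhds htarget)] with y hy hytarget
  rw [chart_symm_eq hytarget]
  exact hy.2

/-- The coordinates of `q` in the preferred chart at `q`; a representative of `q` in
`ℂⁿ \ {0}`. -/
def chartPoint (q : Hopf n a) : Cn n := chartAt (Cn n) q q

theorem chartPoint_ne_zero (q : Hopf n a) : chartPoint q ≠ 0 :=
  chart_target_ne_zero (mem_chart_target _ q)

theorem exists_frame_eq_smul (hp : p ∈ (chartAt (Cn n) q).source) :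
    ∃ c : ℝ, 0 < c ∧ chartPoint p = c • chartAt (Cn n) q p ∧
      ∀ v : Cn n, frame q p v = (c • v : Cn n) := by
  obtain ⟨c, hc, hnear⟩ := exists_chart_chart_symm_eq hp (mem_chart_source (Cn n) p)
  refine ⟨c, hc, ?_, fun v ↦ ?_⟩
  · have hpoint := hnear.self_of_nhds
    rwa [(chartAt (Cn n) q).left_inv hp] at hpoint
  · have hsmul : HasFDerivAt (fun z : Cn n ↦ c • z) (c • ContinuousLinearMap.id ℝ (Cn n))
        (chartAt (Cn n) q p) := (hasFDerivAt_id _).const_smul c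
    rw [frame, TangentBundle.symmL_trivializationAt_eq_core hp,
      tangentBundleCore_coordChange_achart]
    simp only [mfld_simps, fderivWithin_univ]
    exact DFunLike.congr_fun (hsmul.congr_of_eventuallyEq hnear).fderiv v

theorem exists_mfderiv_hopfProj_eq_smul (x : punctured n) :
    ∃ c : ℝ, 0 < c ∧ chartPoint (hopfProj a x) = c • (x : Cn n) ∧
      ∀ v : Cn n, mfderiv 𝓘(ℝ, Cn n) 𝓘(ℝ, Cn n) (hopfProj a) x v = (c • v : Cn n) := by
  obtain ⟨c, hc, hnear⟩ := exists_chart_hopfProj_eq (mem_chart_source (Cn n) (hopfProj a x))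
  refine ⟨c, hc, hnear.self_of_nhds.2, fun v ↦ ?_⟩
  have hsmul : HasFDerivAt (fun z : Cn n ↦ c • z) (c • ContinuousLinearMap.id ℝ (Cn n))
      (x : Cn n) := (hasFDerivAt_id _).const_smul c
  have hproj : HasMFDerivAt 𝓘(ℝ, Cn n) 𝓘(ℝ, Cn n) (hopfProj a) x
      (c • ContinuousLinearMap.id ℝ (Cn n)) := by
    refine ⟨continuous_hopfProj.continuousAt, (hsmul.congr_of_eventuallyEq
      (eventually_nhds_coe_iff.2 ?_)).hasFDerivWithinAt⟩
    filter_upwards [hnear, chart_source_mem_nhds (Cn n) x] with y hy hysource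
    exact (congrArg (fun y ↦ chartAt (Cn n) (hopfProj a x) (hopfProj a y))
      ((chartAt (Cn n) x).left_inv hysource)).trans hy.2
  rw [hproj.mfderiv]
  rfl

section Smooth

variable {F : Type*} [NormedAddCommGroup F] [NormedSpace ℝ F] {H : Type*} [TopologicalSpace H]
  {I : ModelWithCorners ℝ F H} {N : Type*} [TopologicalSpace N] [ChartedSpace H N]

theorem contMDiff_of_comp_hopfProj {f : Hopf n a → N} {φ : Cn n → N}
    (hf : ∀ x : punctured n, f (hopfProj a x) = φ x)
    (hφ : ∀ z ≠ 0, ContMDiffAt 𝓘(ℝ, Cn n) I ∞ φ z) : ContMDiff 𝓘(ℝ, Cn n) I ∞ f := by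
  intro q
  refine (ContMDiffAt.comp (f := chartAt (Cn n) q) q (hφ _ (chartPoint_ne_zero q))
    (contMDiffAt_extChartAt (I := 𝓘(ℝ, Cn n)))).congr_of_eventuallyEq ?_
  filter_upwards [chart_source_mem_nhds (Cn n) q] with p hp
  exact (congrArg f (hopfProj_chart hp)).symm.trans (hf _)

theorem contMDiffAt_hopfProj_comp {f : N → punctured n} {y : N}
    (hf : ContMDiffAt I 𝓘(ℝ, Cn n) ∞ (fun t ↦ (f t : Cn n)) y) :
    ContMDiffAt I 𝓘(ℝ, Cn n) ∞ (fun t ↦ hopfProj a (f t)) y := by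
  set q := hopfProj a (f y)
  obtain ⟨c, -, hnear⟩ := exists_chart_hopfProj_eq (x := f y) (mem_chart_source (Cn n) q)
  have hcont : ContinuousAt f y :=
    Topology.IsInducing.subtypeVal.continuousAt_iff.2 hf.continuousAt
  have hsmul : ContMDiffAt I 𝓘(ℝ, Cn n) ∞ (fun t ↦ c • (f t : Cn n)) y :=
    (contDiff_const_smul c).contMDiff.contMDiffAt.comp y hf
  have hchart : ContMDiffAt 𝓘(ℝ, Cn n) 𝓘(ℝ, Cn n) ∞ (chartAt (Cn n) q).symm
      (c • (f y : Cn n)) := by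
    rw [← hnear.self_of_nhds.2]
    exact (contMDiffOn_chart_symm (x := q)).contMDiffAt (chart_target_mem_nhds (Cn n) q)
  refine (hchart.comp y hsmul).congr_of_eventuallyEq ?_
  filter_upwards [hcont.eventually hnear] with t ht
  rw [Function.comp_apply, ← ht.2, (chartAt (Cn n) q).left_inv ht.1]

end Smooth

end HopfCharts

/-! ### The Vaisman structure of the Hopf manifold -/

section HopfTensors

variable {n : ℕ} {a : ℝ} [ha : Fact (1 < a)] {p q : Hopf n a}

theorem mulI_frame (hp : p ∈ (chartAt (Cn n) q).source) (v : Cn n) :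
    mulI n (frame q p v) = frame q p (mulI n v) := by
  obtain ⟨c, -, -, hframe⟩ := exists_frame_eq_smul hp
  rw [hframe, hframe, map_smul]

theorem coframe_mulI (hp : p ∈ (chartAt (Cn n) q).source) (v : Cn n) :
    coframe q p (mulI n v) = mulI n (coframe q p v) := by
  have hframe : frame q p (mulI n (coframe q p v)) = mulI n v :=
    (mulI_frame hp _).symm.trans (congrArg (mulI n) (frame_coframe hp v))
  rw [← coframe_frame hp (mulI n (coframe q p v)), hframe]

theorem isChartParallel_mulI : IsChartParallel (fun _ : Hopf n a ↦ mulI n) := by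
  intro q X hX v
  have hinChart : inChart q (fun p ↦ mulI n (X p)) =ᶠ[𝓝 (chartAt (Cn n) q q)]
      mulI n ∘ inChart q X := by
    filter_upwards [chart_target_mem_nhds (Cn n) q] with z hz
    exact coframe_mulI ((chartAt (Cn n) q).map_target hz) _
  have hderiv := ((mulI n).hasFDerivAt.comp _ hX.differentiableAt_inChart.hasFDerivAt).fderiv
  exact DFunLike.congr_fun (hinChart.fderiv_eq.trans hderiv) v

variable (n a) in
/-- The complex structure of the Hopf manifold, induced by multiplication by `i`. -/
def hopfJ : ComplexStructure (Cn n) (Hopf n a) where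
  toFun _ := mulI n
  smooth := by
    refine smoothEnd_iff.2 fun q ↦
      (contMDiffAt_const (c := mulI n)).congr_of_eventuallyEq ?_
    filter_upwards [chart_source_mem_nhds (Cn n) q] with p hp
    ext1 v
    exact (coframe_mulI hp _).trans (congrArg (mulI n) (coframe_frame hp v))
  sq _ v := mulI_mulI v
  nijenhuis _ _ _ hX hY := isChartParallel_mulI.nijenhuis_eq_zero (fun _ v ↦ mulI_mulI v) hX hY

theorem cylMetric_frame (hp : p ∈ (chartAt (Cn n) q).source) (v w : Cn n) :
    cylMetric (chartPoint p) (frame q p v) (frame q p w) =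
      cylMetric (chartAt (Cn n) q p) v w := by
  obtain ⟨c, hc, hpoint, hframe⟩ := exists_frame_eq_smul hp
  rw [hpoint, hframe, hframe, cylMetric_smul hc.ne']

theorem cylLee_frame (hp : p ∈ (chartAt (Cn n) q).source) (v : Cn n) :
    cylLee (chartPoint p) (frame q p v) = cylLee (chartAt (Cn n) q p) v := by
  obtain ⟨c, hc, hpoint, hframe⟩ := exists_frame_eq_smul hp
  rw [hpoint, hframe, cylLee_smul hc.ne']

theorem coordForm2_cylMetric (hp : p ∈ (chartAt (Cn n) q).source) :
    coordForm2 (fun p : Hopf n a ↦ cylMetric (chartPoint p)) q p =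
      cylMetric (chartAt (Cn n) q p) := by
  ext v w
  exact (coordForm2_apply _ _ _ _ _).trans (cylMetric_frame hp v w)

variable (n a) in
/-- The metric of the Hopf manifold induced by `4 r⁻² g_{ℂⁿ}`. -/
def hopfMetric : RMetric (Cn n) (Hopf n a) where
  inner q := cylMetric (chartPoint q)
  symm q v w := cylMetric_comm (chartPoint q) v w
  pos q _ hv := cylMetric_self_pos (chartPoint_ne_zero q) hv
  isVonNBounded q :=
    isVonNBounded_of_pos (E := Cn n) fun _ hv ↦ cylMetric_self_pos (chartPoint_ne_zero q) hv
  contMDiff := smoothForm2_of_coordForm2_eq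
    (fun q ↦ contDiffAt_cylMetric (chartPoint_ne_zero q)) fun _ _ hp ↦ coordForm2_cylMetric hp

variable (n a) in
/-- The Lee form of the Hopf manifold, induced by `-2 dr / r`. -/
def hopfLee : Form1 (Cn n) (Hopf n a) := fun q ↦ cylLee (chartPoint q)

theorem hopfLee_comp_frame (hp : p ∈ (chartAt (Cn n) q).source) :
    (hopfLee n a p).comp (frame q p) = cylLee (chartAt (Cn n) q p) := by
  ext v
  exact cylLee_frame hp v

theorem smoothForm1_hopfLee : SmoothForm1 (hopfLee n a) :=
  smoothForm1_of_comp_frame_eq (fun q ↦ contDiffAt_cylLee (chartPoint_ne_zero q))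
    fun _ _ hp ↦ hopfLee_comp_frame hp

theorem isChartWeyl_hopf : IsChartWeyl (hopfMetric n a) (hopfLee n a) := by
  intro q X Y hX hY v
  have hdiff := SmoothForm2.diff_apply_eq_fderiv (x := q) (hopfMetric n a).contMDiff
    (fun p hp ↦ coordForm2_cylMetric hp) hX hY
  have hderiv := fderiv_cylMetric_apply (chartPoint_ne_zero q) hX.differentiableAt_inChart
    hY.differentiableAt_inChart v
  rw [chartPoint, inChart_self, inChart_self] at hderiv
  exact (DFunLike.congr_fun hdiff v).trans hderiv

theorem hasCylindricalLeeForm_hopf : HasCylindricalLeeForm (hopfMetric n a) (hopfLee n a) := by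
  intro q Y hY v
  have hdiff := smoothForm1_hopfLee.diff_apply_eq_fderiv (fun p hp ↦ hopfLee_comp_frame hp) hY
  have hderiv := fderiv_cylLee_apply (chartPoint_ne_zero q) hY.differentiableAt_inChart v
  rw [chartPoint, inChart_self] at hderiv
  exact (DFunLike.congr_fun hdiff v).trans hderiv

theorem hopfLee_sharp (q : Hopf n a) :
    hopfLee n a q (sharp (hopfMetric n a) (hopfLee n a) q) = 1 := by
  have hsharp : sharp (hopfMetric n a) (hopfLee n a) q = (-(1 / 2 : ℝ) • chartPoint q : Cn n) :=
    (sharp_eq_iff _ _).2 fun _ ↦ rfl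
  exact (congrArg (hopfLee n a q) hsharp).trans
    (cylLee_apply_self (F := Cn n) (chartPoint_ne_zero q))

theorem isVaismanWith_hopf : IsVaismanWith (hopfJ n a) (hopfMetric n a) (hopfLee n a) :=
  isVaismanWith_of_isChartWeyl isChartWeyl_hopf isChartParallel_mulI
    (fun q v w ↦ cylMetric_mulI_mulI (chartPoint q) v w) smoothForm1_hopfLee
    hasCylindricalLeeForm_hopf hopfLee_sharp

theorem hopfJ_mfderiv (x : punctured n) (v : Cn n) :
    hopfJ n a (hopfProj a x) (mfderiv 𝓘(ℝ, Cn n) 𝓘(ℝ, Cn n) (hopfProj a) x v) =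
      mfderiv 𝓘(ℝ, Cn n) 𝓘(ℝ, Cn n) (hopfProj a) x (Complex.I • v : Cn n) := by
  obtain ⟨c, -, -, hderiv⟩ := exists_mfderiv_hopfProj_eq_smul (a := a) x
  rw [hderiv, hderiv]
  exact map_smul (mulI n) c v

theorem hopfMetric_mfderiv (x : punctured n) (v w : Cn n) :
    (hopfMetric n a).inner (hopfProj a x) (mfderiv 𝓘(ℝ, Cn n) 𝓘(ℝ, Cn n) (hopfProj a) x v)
      (mfderiv 𝓘(ℝ, Cn n) 𝓘(ℝ, Cn n) (hopfProj a) x w) =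
        4 / ‖(x : Cn n)‖ ^ 2 * inner ℝ v w := by
  obtain ⟨c, hc, hpoint, hderiv⟩ := exists_mfderiv_hopfProj_eq_smul (a := a) x
  rw [hderiv, hderiv, ← cylMetric_apply, ← cylMetric_smul hc.ne', ← hpoint]
  rfl

theorem hopfLee_mfderiv (x : punctured n) (v : Cn n) :
    hopfLee n a (hopfProj a x) (mfderiv 𝓘(ℝ, Cn n) 𝓘(ℝ, Cn n) (hopfProj a) x v) =
      cylLee (x : Cn n) v := by
  obtain ⟨c, hc, hpoint, hderiv⟩ := exists_mfderiv_hopfProj_eq_smul (a := a) x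
  rw [hderiv, ← cylLee_smul hc.ne', ← hpoint]
  rfl

theorem contMDiff_norm_punctured :
    ContMDiff 𝓘(ℝ, Cn n) 𝓘(ℝ, ℝ) ∞ (fun y : punctured n ↦ ‖(y : Cn n)‖) := fun y ↦
  ((contDiffAt_norm ℝ (punctured_ne_zero y)).contMDiffAt (n := ∞)).comp y
    contMDiff_subtype_val.contMDiffAt

theorem diff_norm_punctured (x : punctured n) :
    diff (E := Cn n) (fun y : punctured n ↦ ‖(y : Cn n)‖) x =
      -(‖(x : Cn n)‖ / 2) • cylLee (x : Cn n) := by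
  have hnorm : (fun y : punctured n ↦ ‖(y : Cn n)‖) ∘ (chartAt (Cn n) x).symm
      =ᶠ[𝓝 (x : Cn n)] fun z ↦ ‖z‖ := by
    filter_upwards [chart_target_mem_nhds (Cn n) x] with z hz
    exact congrArg norm ((chartAt (Cn n) x).right_inv hz)
  rw [diff_eq_fderiv ((contMDiff_norm_punctured x).mdifferentiableAt (by simp))]
  exact hnorm.fderiv_eq.trans (hasFDerivAt_norm_of_ne_zero (punctured_ne_zero x)).fderiv

theorem cylLee_eq_neg_two_mul_diff_norm_div (x : punctured n) (v : Cn n) :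
    cylLee (x : Cn n) v =
      -2 * diff (E := Cn n) (fun y : punctured n ↦ ‖(y : Cn n)‖) x v / ‖(x : Cn n)‖ := by
  have hx : ‖(x : Cn n)‖ ≠ 0 := norm_ne_zero_iff.2 (punctured_ne_zero x)
  rw [diff_norm_punctured]
  change _ = -2 * (-(‖(x : Cn n)‖ / 2) * cylLee (x : Cn n) v) / ‖(x : Cn n)‖
  field_simp

end HopfTensors

/-! ### Radial functions -/

section Radial

variable {n : ℕ} {a : ℝ} [ha : Fact (1 < a)] {h : ℝ → ℝ} {f : Hopf n a → ℝ}

theorem norm_dilation_smul (k : Dilations a) (x : punctured n) :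
    ‖((k • x : punctured n) : Cn n)‖ = a ^ k.exponent * ‖(x : Cn n)‖ := by
  rw [coe_dilation_smul, norm_smul, Real.norm_of_nonneg (dilation_pos _).le]

theorem IsRadialProfile.zpow_mul (hh : IsRadialProfile a h) (k : ℤ) {r : ℝ} (hr : 0 < r) :
    h (a ^ k * r) = h r := by
  have ha0 : 0 < a := zero_lt_one.trans ha.out
  induction k using Int.induction_on generalizing r with
  | zero => rw [zpow_zero, one_mul]
  | succ k ih => rw [zpow_add_one₀ ha0.ne', mul_assoc, ih (mul_pos ha0 hr), hh.periodic r hr]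
  | pred k ih =>
    have hr' : 0 < a⁻¹ * r := mul_pos (inv_pos.2 ha0) hr
    rw [zpow_sub_one₀ ha0.ne', mul_assoc, ih hr', ← hh.periodic _ hr',
      mul_inv_cancel_left₀ ha0.ne']

theorem IsRadialProfile.exists_comp_hopfProj_eq (hh : IsRadialProfile a h) :
    ∃ f : Hopf n a → ℝ, ∀ x : punctured n, f (hopfProj a x) = h ‖(x : Cn n)‖ :=
  ⟨hopfLift (fun x ↦ h ‖(x : Cn n)‖) fun k x ↦ by
    rw [norm_dilation_smul, hh.zpow_mul _ (norm_pos_iff.2 (punctured_ne_zero x))], fun _ ↦ rfl⟩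

theorem contMDiff_radial (hh : ContDiffOn ℝ ∞ h (Set.Ioi 0))
    (hf : ∀ x : punctured n, f (hopfProj a x) = h ‖(x : Cn n)‖) :
    ContMDiff 𝓘(ℝ, Cn n) 𝓘(ℝ, ℝ) ∞ f :=
  contMDiff_of_comp_hopfProj (φ := fun z ↦ h ‖z‖) hf fun z hz ↦
    ((hh.contDiffAt (Ioi_mem_nhds (norm_pos_iff.2 hz))).comp z (contDiffAt_norm ℝ hz)).contMDiffAt

theorem diff_radial_apply (hh : ContDiffOn ℝ ∞ h (Set.Ioi 0))
    (hf : ∀ x : punctured n, f (hopfProj a x) = h ‖(x : Cn n)‖) (q : Hopf n a)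
    (v : TangentSpace 𝓘(ℝ, Cn n) q) :
    diff f q v = deriv h ‖chartPoint q‖ * -(‖chartPoint q‖ / 2) * hopfLee n a q v := by
  have hq := chartPoint_ne_zero q
  have hradial : f ∘ (chartAt (Cn n) q).symm =ᶠ[𝓝 (chartPoint q)] h ∘ (‖·‖) := by
    filter_upwards [chart_target_mem_nhds (Cn n) q] with z hz
    rw [Function.comp_apply, chart_symm_eq hz, hf, Function.comp_apply]
  have hderiv : HasDerivAt h (deriv h ‖chartPoint q‖) ‖chartPoint q‖ :=
    ((hh.contDiffAt (Ioi_mem_nhds (norm_pos_iff.2 hq))).differentiableAt (by simp)).hasDerivAt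
  rw [diff_eq_fderiv ((contMDiff_radial hh hf q).mdifferentiableAt (by simp)), mul_assoc]
  exact DFunLike.congr_fun (hradial.fderiv_eq.trans
    (hderiv.comp_hasFDerivAt _ (hasFDerivAt_norm_of_ne_zero hq)).fderiv) v

theorem not_exists_forall_eq_radial [NeZero n] (hh : ¬ ∃ c : ℝ, ∀ r, 0 < r → h r = c)
    (hf : ∀ x : punctured n, f (hopfProj a x) = h ‖(x : Cn n)‖) : ¬ ∃ c : ℝ, ∀ q, f q = c := by
  rintro ⟨c, hc⟩
  refine hh ⟨c, fun r hr ↦ ?_⟩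
  obtain ⟨z, rfl⟩ := exists_norm_eq (Cn n) hr.le
  rw [← hc (hopfProj a ⟨z, norm_pos_iff.1 hr⟩), hf]

theorem IsRadialProfile.isAdmissible [NeZero n] (hh : IsRadialProfile a h)
    (hf : ∀ x : punctured n, f (hopfProj a x) = h ‖(x : Cn n)‖) :
    IsAdmissible (hopfLee n a) f where
  smooth := contMDiff_radial hh.smooth hf
  nonconst := not_exists_forall_eq_radial hh.nonconst hf
  gt_neg_one q := by
    obtain ⟨x, rfl⟩ := hopfProj_surjective q
    rw [hf]
    exact (abs_lt.1 (hh.abs_lt_one _ (norm_pos_iff.2 (punctured_ne_zero x)))).1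
  wedge_eq_zero q := by
    ext v w
    rw [wedge_apply, diff_radial_apply hh.smooth hf, diff_radial_apply hh.smooth hf]
    change _ = (0 : ℝ)
    ring

end Radial

theorem isRadialProfile_sin {a : ℝ} (ha : 1 < a) : IsRadialProfile a
    (fun r ↦ 1 / 2 * Real.sin (2 * Real.pi * Real.log r / Real.log a)) where
  smooth := contDiffOn_const.mul (Real.contDiff_sin.comp_contDiffOn
    ((contDiffOn_const.mul (contDiffOn_id.log fun _ hr ↦ (Set.mem_Ioi.1 hr).ne')).div_const _))
  nonconst := by
    rintro ⟨c, hc⟩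
    have hlog : Real.log a ≠ 0 := (Real.log_pos ha).ne'
    have hzero := hc 1 one_pos
    have hhalf := hc (Real.exp (Real.log a / 4)) (Real.exp_pos _)
    have hangle : 2 * Real.pi * (Real.log a / 4) / Real.log a = Real.pi / 2 := by
      field_simp
      norm_num
    simp only [Real.log_one, mul_zero, zero_div, Real.sin_zero] at hzero
    simp only [Real.log_exp, hangle, Real.sin_pi_div_two] at hhalf
    linarith
  abs_lt_one r _ := by
    have hsin := Real.abs_sin_le_one (2 * Real.pi * Real.log r / Real.log a)
    rw [abs_mul, abs_of_pos one_half_pos]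
    linarith
  periodic r hr := by
    have hlog : Real.log a ≠ 0 := (Real.log_pos ha).ne'
    have hangle : 2 * Real.pi * Real.log (a * r) / Real.log a =
        2 * Real.pi * Real.log r / Real.log a + 2 * Real.pi := by
      rw [Real.log_mul (zero_lt_one.trans ha).ne' hr.ne']
      field_simp
      ring
    simp only [hangle, Real.sin_add_two_pi]

/-! ### Polar coordinates on the Hopf manifold -/

section Circle

theorem contDiffAt_arg {z : ℂ} (hz : z ∈ Complex.slitPlane) : ContDiffAt ℝ ∞ Complex.arg z := by
  have harg : Complex.arg = Complex.imCLM ∘ Complex.log :=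
    funext fun w ↦ (Complex.log_im w).symm
  rw [harg]
  exact Complex.imCLM.contDiff.contDiffAt.comp z ((Complex.contDiffAt_log hz).restrict_scalars ℝ)

theorem contMDiff_coe_circle : ContMDiff (𝓡 1) 𝓘(ℝ, ℂ) ∞ (fun u : Circle ↦ (u : ℂ)) :=
  haveI : Fact (Module.finrank ℝ ℂ = 1 + 1) := ⟨Complex.finrank_real_complex⟩
  contMDiff_coe_sphere (E := ℂ) (n := 1)

theorem contMDiffAt_arg_div (u₀ : Circle) :
    ContMDiffAt (𝓡 1) 𝓘(ℝ, ℝ) ∞ (fun u : Circle ↦ Complex.arg ((u / u₀ : Circle) : ℂ)) u₀ := by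
  have harg : ContDiffAt ℝ ∞ (fun w : ℂ ↦ Complex.arg (w / u₀)) u₀ := by
    refine ContDiffAt.comp (g := Complex.arg) (u₀ : ℂ) (contDiffAt_arg ?_)
      (contDiffAt_id.div_const _)
    rw [div_self (Circle.coe_ne_zero u₀)]
    exact Complex.one_mem_slitPlane
  exact harg.contMDiffAt.comp u₀ (contMDiff_coe_circle u₀)

end Circle

section Polar

variable {n : ℕ} {a : ℝ}

variable (a) in
/-- The point `a ^ (t / 2π) s` of `ℂⁿ \ {0}`, for `s` in the unit sphere. -/
def polarPoint (t : ℝ) (s : Metric.sphere (0 : Cn n) 1) : punctured n :=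
  ⟨Real.exp (Real.log a * t / (2 * Real.pi)) • (s : Cn n),
    smul_ne_zero (Real.exp_pos _).ne' (ne_zero_of_mem_unit_sphere s)⟩

theorem coe_polarPoint (t : ℝ) (s : Metric.sphere (0 : Cn n) 1) : (polarPoint a t s : Cn n) =
    Real.exp (Real.log a * t / (2 * Real.pi)) • (s : Cn n) := rfl

theorem norm_polarPoint (t : ℝ) (s : Metric.sphere (0 : Cn n) 1) :
    ‖(polarPoint a t s : Cn n)‖ = Real.exp (Real.log a * t / (2 * Real.pi)) := by
  rw [coe_polarPoint, norm_smul, norm_eq_of_mem_sphere, mul_one,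
    Real.norm_of_nonneg (Real.exp_pos _).le]

/-- The direction `z / |z|` of a point of `ℂⁿ \ {0}`. -/
def direction (x : punctured n) : Metric.sphere (0 : Cn n) 1 :=
  ⟨‖(x : Cn n)‖⁻¹ • (x : Cn n), by
    rw [mem_sphere_zero_iff_norm, norm_smul, norm_inv, norm_norm,
      inv_mul_cancel₀ (norm_ne_zero_iff.2 (punctured_ne_zero x))]⟩

theorem coe_direction (x : punctured n) :
    (direction x : Cn n) = ‖(x : Cn n)‖⁻¹ • (x : Cn n) := rfl

/-- The angular coordinate `2π log |z| / log a`. -/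
def radialAngle (a : ℝ) (z : Cn n) : ℝ := 2 * Real.pi * Real.log ‖z‖ / Real.log a

theorem contDiffAt_radialAngle {z : Cn n} (hz : z ≠ 0) :
    ContDiffAt ℝ ∞ (radialAngle a : Cn n → ℝ) z :=
  (contDiffAt_const.mul ((contDiffAt_norm ℝ hz).log (norm_ne_zero_iff.2 hz))).div_const _

theorem direction_polarPoint (t : ℝ) (s : Metric.sphere (0 : Cn n) 1) :
    direction (polarPoint a t s) = s := by
  refine Subtype.ext ?_
  rw [coe_direction, norm_polarPoint, coe_polarPoint, inv_smul_smul₀ (Real.exp_pos _).ne']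

variable [ha : Fact (1 < a)]

theorem radialAngle_polarPoint (t : ℝ) (s : Metric.sphere (0 : Cn n) 1) :
    radialAngle a (polarPoint a t s : Cn n) = t := by
  have hlog : Real.log a ≠ 0 := (Real.log_pos ha.out).ne'
  rw [radialAngle, norm_polarPoint, Real.log_exp]
  field_simp

theorem polarPoint_radialAngle_direction (x : punctured n) :
    polarPoint a (radialAngle a (x : Cn n)) (direction x) = x := by
  have hlog : Real.log a ≠ 0 := (Real.log_pos ha.out).ne'
  have hx : 0 < ‖(x : Cn n)‖ := norm_pos_iff.2 (punctured_ne_zero x)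
  have hradius : Real.log a * radialAngle a (x : Cn n) / (2 * Real.pi) =
      Real.log ‖(x : Cn n)‖ := by
    rw [radialAngle]
    field_simp
  refine Subtype.ext ?_
  rw [coe_polarPoint, hradius, Real.exp_log hx, coe_direction, smul_inv_smul₀ hx.ne']

theorem dilation_smul_polarPoint (k : Dilations a) (t : ℝ) (s : Metric.sphere (0 : Cn n) 1) :
    k • polarPoint a t s = polarPoint a (t + k.exponent * (2 * Real.pi)) s := by
  refine Subtype.ext ?_
  rw [coe_dilation_smul, coe_polarPoint, coe_polarPoint, smul_smul,
    ← Real.exp_log (dilation_pos (a := a) k.exponent), ← Real.exp_add, Real.log_zpow]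
  congr 2
  field_simp
  ring

theorem radialAngle_dilation_smul (k : Dilations a) (x : punctured n) :
    radialAngle a ((k • x : punctured n) : Cn n) =
      radialAngle a (x : Cn n) + k.exponent * (2 * Real.pi) := by
  rw [← polarPoint_radialAngle_direction (a := a) x, dilation_smul_polarPoint,
    radialAngle_polarPoint, radialAngle_polarPoint]

theorem direction_dilation_smul (k : Dilations a) (x : punctured n) :
    direction (k • x) = direction x := by
  rw [← polarPoint_radialAngle_direction (a := a) x, dilation_smul_polarPoint,
    direction_polarPoint, direction_polarPoint]

theorem hopfProj_polarPoint_congr {t t' : ℝ} (h : Circle.exp t = Circle.exp t')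
    (s : Metric.sphere (0 : Cn n) 1) :
    hopfProj a (polarPoint a t s) = hopfProj a (polarPoint a t' s) := by
  obtain ⟨m, rfl⟩ := Circle.exp_eq_exp.1 h
  exact hopfProj_eq_iff.2 ⟨(Multiplicative.ofAdd m : Multiplicative ℤ),
    dilation_smul_polarPoint _ _ _⟩

variable (n a) in
/-- The circle coordinate of the Hopf manifold. -/
def hopfAngle : Hopf n a → Circle :=
  hopfLift (fun x ↦ Circle.exp (radialAngle a (x : Cn n))) fun k x ↦ by
    rw [radialAngle_dilation_smul]
    exact Circle.exp_eq_exp.2 ⟨_, rfl⟩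

variable (n a) in
/-- The sphere coordinate of the Hopf manifold. -/
def hopfDirection : Hopf n a → Metric.sphere (0 : Cn n) 1 :=
  hopfLift direction direction_dilation_smul

theorem contMDiff_hopfAngle : ContMDiff 𝓘(ℝ, Cn n) (𝓡 1) ∞ (hopfAngle n a) :=
  contMDiff_of_comp_hopfProj (φ := fun z ↦ Circle.exp (radialAngle a z)) (fun _ ↦ rfl)
    fun z hz ↦ contMDiff_circleExp.contMDiffAt.comp z (contDiffAt_radialAngle hz).contMDiffAt

section Diffeomorph

variable {m : ℕ} [Fact (Module.finrank ℝ (Cn n) = m + 1)]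

theorem contMDiff_hopfDirection : ContMDiff 𝓘(ℝ, Cn n) (𝓡 m) ∞ (hopfDirection n a) := by
  have hcoe : ContMDiff 𝓘(ℝ, Cn n) 𝓘(ℝ, Cn n) ∞ (fun q ↦ (hopfDirection n a q : Cn n)) :=
    contMDiff_of_comp_hopfProj (φ := fun z ↦ ‖z‖⁻¹ • z) (fun _ ↦ rfl) fun z hz ↦
      (((contDiffAt_norm ℝ hz).inv (norm_ne_zero_iff.2 hz)).smul contDiffAt_id).contMDiffAt
  exact hcoe.codRestrict_sphere fun q ↦ (hopfDirection n a q).2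

-- `arg` jumps at `-1`, but near `u₀` it may be replaced by `arg (u / u₀) + arg u₀`.
theorem contMDiff_hopfProj_polarPoint : ContMDiff ((𝓡 1).prod (𝓡 m)) 𝓘(ℝ, Cn n) ∞
    (fun y : Circle × Metric.sphere (0 : Cn n) 1 ↦
      hopfProj a (polarPoint a (Complex.arg y.1) y.2)) := by
  rintro ⟨u₀, s₀⟩
  have hangle (y : Circle × Metric.sphere (0 : Cn n) 1) :
      hopfProj a (polarPoint a (Complex.arg y.1) y.2) =
      hopfProj a (polarPoint a (Complex.arg ((y.1 / u₀ : Circle) : ℂ) + Complex.arg u₀) y.2) := by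
    refine hopfProj_polarPoint_congr ?_ _
    rw [Circle.exp_add, Circle.exp_arg, Circle.exp_arg, Circle.exp_arg, div_mul_cancel]
  simp only [hangle]
  refine contMDiffAt_hopfProj_comp ?_
  have harg : ContMDiffAt ((𝓡 1).prod (𝓡 m)) 𝓘(ℝ, ℝ) ∞
      (fun y : Circle × Metric.sphere (0 : Cn n) 1 ↦ Complex.arg ((y.1 / u₀ : Circle) : ℂ))
      (u₀, s₀) := (contMDiffAt_arg_div u₀).comp (u₀, s₀) contMDiffAt_fst
  have hdirection : ContMDiffAt ((𝓡 1).prod (𝓡 m)) 𝓘(ℝ, Cn n) ∞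
      (fun y : Circle × Metric.sphere (0 : Cn n) 1 ↦ (y.2 : Cn n)) (u₀, s₀) :=
    (contMDiff_coe_sphere s₀).comp (u₀, s₀) contMDiffAt_snd
  have hradius : ContDiff ℝ ∞ (fun t : ℝ ↦
      Real.exp (Real.log a * (t + Complex.arg u₀) / (2 * Real.pi))) := by fun_prop
  exact (hradius.contMDiff.contMDiffAt.comp (u₀, s₀) harg).smul hdirection

variable (n a m) in
/-- The diffeomorphism `Hopf n a ≅ S¹ × S^m` given by polar coordinates, where `m + 1 = 2n`. -/
def hopfDiffeomorph : Diffeomorph 𝓘(ℝ, Cn n) ((𝓡 1).prod (𝓡 m))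
    (Hopf n a) (Circle × Metric.sphere (0 : Cn n) 1) ∞ where
  toFun q := (hopfAngle n a q, hopfDirection n a q)
  invFun y := hopfProj a (polarPoint a (Complex.arg y.1) y.2)
  left_inv q := by
    obtain ⟨x, rfl⟩ := hopfProj_surjective q
    exact (hopfProj_polarPoint_congr (Circle.exp_arg _) _).trans
      (congrArg (hopfProj a) (polarPoint_radialAngle_direction x))
  right_inv y := Prod.ext
    ((congrArg Circle.exp (radialAngle_polarPoint _ _)).trans (Circle.exp_arg _))
    (direction_polarPoint _ _)
  contMDiff_toFun := contMDiff_hopfAngle.prodMk contMDiff_hopfDirection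
  contMDiff_invFun := contMDiff_hopfProj_polarPoint

end Diffeomorph

instance [NeZero n] : ConnectedSpace (Metric.sphere (0 : Cn n) 1) := by
  have hrank : 1 < Module.rank ℝ (Cn n) := by
    rw [← Module.finrank_eq_rank, finrank_real_of_complex, finrank_euclideanSpace_fin]
    exact_mod_cast (by have := NeZero.pos n; omega : 1 < 2 * n)
  exact isConnected_iff_connectedSpace.1 (isConnected_sphere hrank _ zero_le_one)

end Polar

end

end LCK

theorem lemma6 :
    -- the deformation of a Vaisman metric with Lee form of norm one
    (∀ (E : Type u) [NormedAddCommGroup E] [NormedSpace ℝ E] [FiniteDimensional ℝ E]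
      (M : Type v) [TopologicalSpace M] [T2Space M] [SecondCountableTopology M]
      [ChartedSpace E M] [IsManifold 𝓘(ℝ, E) ∞ M]
      (n : ℕ) (_hn : 2 ≤ n) (_hdim : Module.finrank ℝ E = 2 * n)
      (J : ComplexStructure E M) (g : RMetric E M) (θ : Form1 E M)
      (_hV : IsVaismanWith J g θ) (_hθ : ∀ x, fnorm g θ x = 1),
      -- `df ∧ θ = 0` says that the gradient of `f` is collinear to the Lee field
      (∀ f : M → ℝ, (∀ x, wedge (diff f) θ x = 0) ↔
        ∀ x, ∃ c : ℝ, sharp g (diff f) x = c • sharp g θ x) ∧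
      ∀ f : M → ℝ, IsAdmissible θ f → ∃ gbar : RMetric E M,
        (∀ (x : M) (v w : TangentSpace 𝓘(ℝ, E) x),
          gbar.inner x v w = deformedForm J g θ f x v (J x w)) ∧
        fundamentalForm J gbar = deformedForm J g θ f ∧
        IsLCKWith J gbar (fun x ↦ (1 + f x) • θ x) ∧
        sharp gbar (fun x ↦ (1 + f x) • θ x) = sharp g θ ∧
        IsHolomorphic J (sharp g θ) ∧
        (∀ x, gbar.inner x (sharp g θ x) (sharp g θ x) = 1 + f x) ∧
        (¬ ∃ c : ℝ, ∀ x, vnorm gbar (sharp g θ) x = c) ∧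
        (ConnectedSpace M → ¬ IsVaisman J gbar)) ∧
    -- the Hopf manifold
    (∀ (n : ℕ) (a : ℝ) [Fact (1 < a)] (hn : 2 ≤ n),
      haveI : Fact (Module.finrank ℝ (Cn n) = 2 * n - 1 + 1) := ⟨finrank_Cn hn⟩
      T2Space (Hopf n a) ∧ SecondCountableTopology (Hopf n a) ∧
      CompactSpace (Hopf n a) ∧ ConnectedSpace (Hopf n a) ∧
      Nonempty (Diffeomorph 𝓘(ℝ, Cn n) ((𝓡 1).prod (𝓡 (2 * n - 1)))
        (Hopf n a) (Circle × Metric.sphere (0 : Cn n) 1) ∞) ∧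
      IsRadialProfile a (fun r ↦ 1 / 2 * Real.sin (2 * Real.pi * Real.log r / Real.log a)) ∧
      ∃ (J : ComplexStructure (Cn n) (Hopf n a)) (g : RMetric (Cn n) (Hopf n a))
        (θ : Form1 (Cn n) (Hopf n a)),
        -- `J`, `g`, `θ` are induced by `i`, `4 r⁻² g_{ℂⁿ}` and `-2 dr / r`
        (∀ (x : punctured n) (v : Cn n),
          J (hopfProj a x) (mfderiv 𝓘(ℝ, Cn n) 𝓘(ℝ, Cn n) (hopfProj a) x v) =
            mfderiv 𝓘(ℝ, Cn n) 𝓘(ℝ, Cn n) (hopfProj a) x (Complex.I • v : Cn n)) ∧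
        (∀ (x : punctured n) (v w : Cn n),
          g.inner (hopfProj a x) (mfderiv 𝓘(ℝ, Cn n) 𝓘(ℝ, Cn n) (hopfProj a) x v)
              (mfderiv 𝓘(ℝ, Cn n) 𝓘(ℝ, Cn n) (hopfProj a) x w) =
            4 / ‖(x : Cn n)‖ ^ 2 * inner ℝ v w) ∧
        (∀ (x : punctured n) (v : Cn n),
          θ (hopfProj a x) (mfderiv 𝓘(ℝ, Cn n) 𝓘(ℝ, Cn n) (hopfProj a) x v) =
            -2 * diff (E := Cn n) (fun y : punctured n ↦ ‖(y : Cn n)‖) x v / ‖(x : Cn n)‖) ∧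
        IsVaismanWith J g θ ∧ (∀ x, fnorm g θ x = 1) ∧
        ∀ h : ℝ → ℝ, IsRadialProfile a h →
          ∃ f : Hopf n a → ℝ, (∀ x : punctured n, f (hopfProj a x) = h ‖(x : Cn n)‖) ∧
            IsAdmissible θ f ∧
            ∃ gbar : RMetric (Cn n) (Hopf n a),
              (∀ (x : Hopf n a) (v w : TangentSpace 𝓘(ℝ, Cn n) x),
                gbar.inner x v w = deformedForm J g θ f x v (J x w)) ∧
              IsLCKWith J gbar (fun x ↦ (1 + f x) • θ x) ∧
              IsHolomorphic J (sharp gbar (fun x ↦ (1 + f x) • θ x)) ∧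
              ¬ IsVaisman J gbar) := by
  refine ⟨?_, ?_⟩
  · intro E _ _ _ M _ _ _ _ _ n hn hdim J g θ hV hθ
    exact ⟨fun f ↦ forall_congr' fun x ↦
        wedge_eq_zero_iff_exists_sharp_eq_smul (fnorm_eq_one_iff.1 (hθ x)),
      fun f hf ↦ hV.exists_deformation (by omega) hθ hf⟩
  · intro n a ha hn
    have : NeZero n := ⟨by omega⟩
    have : Fact (Module.finrank ℝ (Cn n) = 2 * n - 1 + 1) := ⟨finrank_Cn hn⟩
    let Φ := hopfDiffeomorph n a (2 * n - 1)
    let e := Φ.toHomeomorph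
    have hunit : ∀ q, fnorm (hopfMetric n a) (hopfLee n a) q = 1 := fun q ↦
      fnorm_eq_one_iff.2 (hopfLee_sharp q)
    have hconn : ConnectedSpace (Hopf n a) :=
      e.symm.surjective.connectedSpace e.symm.continuous
    refine ⟨e.symm.t2Space, e.secondCountableTopology, e.symm.compactSpace, hconn, ⟨Φ⟩,
      isRadialProfile_sin ha.out, hopfJ n a, hopfMetric n a, hopfLee n a, hopfJ_mfderiv,
      hopfMetric_mfderiv,
      fun x v ↦ (hopfLee_mfderiv x v).trans (cylLee_eq_neg_two_mul_diff_norm_div x v),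
      isVaismanWith_hopf, hunit, fun h hh ↦ ?_⟩
    obtain ⟨f, hf⟩ := hh.exists_comp_hopfProj_eq (n := n)
    have hadm := hh.isAdmissible hf
    have hdim : 3 ≤ Module.finrank ℝ (Cn n) := by rw [finrank_Cn hn]; omega
    obtain ⟨gbar, hgbar, -, hlck, hsharp, hhol, -, -, hnot⟩ :=
      isVaismanWith_hopf.exists_deformation hdim hunit hadm
    exact ⟨f, hf, hadm, gbar, hgbar, hlck, hsharp ▸ hhol, hnot hconn⟩
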